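/- Let $a>b$ and $0<k^2<1$, put $k'=\sqrt{1-k^2}$, let $\mathrm{sn},\mathrm{cn},\mathrm{dn}$ be the real Jacobi elliptic functions with modulus $k$, and let $\mathsf K=\mathsf K(k)$ be the complete elliptic integral of the first kind. The conics $\frac{x^2}{a+\lambda}+\frac{y^2}{b+\lambda}=1$ $(\lambda\in\mathbb R)$ form the confocal family of $a,b$. **Continuous case.** Let $$x(s_1,s_2)=\frac{f_1(s_1)f_2(s_2)}{\sqrt{a-b}},\qquad y(s_1,s_2)=\frac{g_1(s_1)g_2(s_2)}{\sqrt{a-b}},$$ $$f_1=\sqrt{a-b}\,\mathrm{sn},\quad g_1=\sqrt{a-b}\,\mathrm{cn},\quad f_2=\frac{\sqrt{a-b}}{k}\,\frac{\mathrm{dn}}{\mathrm{cn}},\quad g_2=\frac{k'\sqrt{a-b}}{k}\,\frac1{\mathrm{cn}},$$ for all real $s_1,s_2$ with $\mathrm{cn}(s_2)\ne0$ (in particular for $s_1\in[0,2\mathsf K]$, $s_2\in[0,\mathsf K)$). Then $f_1^2+g_1^2=a-b$ and $f_2^2-g_2^2=a-b$. For every constant $\xi$ all points $(x,y)(s_1,s_2)$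 with $s_1+s_2=\xi$ lie on one straight line, and for every constant $\eta$ all points with $s_2-s_1=\eta$ lie on one straight line. All these lines are tangent to the ellipse $$\frac{x^2}{a_0}+\frac{y^2}{b_0}=1,\qquad a_0=\frac{a-b}{k^2},\quad b_0=\frac{(a-b)k'^2}{k^2},$$ which belongs to the confocal family. **Discrete case.** Let $\delta,c_1,c_2\in\mathbb R$ with $\mathrm{cn}(\delta/2)>0$. For $n_1,n_2\in\frac12\mathbb Z$ with $\mathrm{cn}(\delta n_2+c_2)\neq0$ let $$\boldsymbol x(n_1,n_2)=(x,y),\qquad x=\frac{f_1(n_1)f_2(n_2)}{\sqrt{a-b}},\qquad y=\frac{g_1(n_1)g_2(n_2)}{\sqrt{a-b}},$$ where now $$f_1(n)=\hat\alpha\,\mathrm{sn}(\delta n+c_1),\quad g_1(n)=\hat\beta\,\mathrm{cn}(\delta n+c_1),\quad f_2(n)=\frac{\hat\alpha}{k}\,\frac{\mathrm{dn}(\delta n+c_2)}{\mathrm{cn}(\delta n+c_2)},\quad g_2(n)=\frac{k'\hat\beta}{k}\,\frac1{\mathrm{cn}(\delta n+c_2)},$$ $$\hat\alpha=\sqrt{(a-b)\frac{\mathrm{dn}(\delta/2)}{\mathrm{cn}(\delta/2)}},\qquad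 \hat\beta=\sqrt{\frac{a-b}{\mathrm{cn}(\delta/2)}}.$$ Then $f_1(n)f_1(n+\frac12)+g_1(n)g_1(n+\frac12)=a-b$ and $f_2(n)f_2(n+\frac12)-g_2(n)g_2(n+\frac12)=a-b$ wherever these are defined. For every $\xi$ all points $\boldsymbol x(n_1,n_2)$ with $n_1+n_2=\xi$ lie on one straight line, and for every $\eta$ all points with $n_1-n_2=\eta$ lie on one straight line. All these lines are tangent to the ellipse $$\frac{x^2}{\hat a_0}+\frac{y^2}{\hat b_0}=1,\qquad \hat a_0=\frac{a-b}{k^2}\,\frac{\mathrm{dn}^2(\delta/2)}{\mathrm{cn}^2(\delta/2)},\quad \hat b_0=\frac{(a-b)k'^2}{k^2}\,\frac1{\mathrm{cn}^2(\delta/2)},$$ which belongs to the confocal family. **Incircular nets.** An *IC-net* on a domain $U\subseteq\mathbb Z^2$ is a map $h:U\to\mathbb R^2$ such that for every $i$ the points $h(i,\cdot)$ lie on a straight line, with $h(i,j)$ strictly between $h(i,j-1)$ and $h(i,j+1)$ when all three are defined, the same holds for the points $h(\cdot,j)$, and for every square $(i,j),(i+1,j),(i+1,j+1),(i,j+1)$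 in $U$ there is a circle of positive radius touching the four sides of the quadrilateral formed by the images of these vertices (an incircle). Let $$T(x,y)=\Big(\frac{\mathrm{cn}(\delta/2)}{\mathrm{dn}(\delta/2)}\,x,\ \mathrm{cn}(\delta/2)\,y\Big),$$ an invertible affine map. Then $T$ maps the discrete point $\boldsymbol x(n_1,n_2)$ to the point of the continuous system with $s_1=\delta n_1+c_1$, $s_2=\delta n_2+c_2$. If $\delta\ne0$, then for $\varepsilon=0$ and for $\varepsilon=1$ the net $$(i,j)\mapsto T\,\boldsymbol x\Big(\frac{i+j+\varepsilon}2,\frac{i-j}2\Big)$$ on the domain of all $(i,j)\in\mathbb Z^2$ with $\delta\,\frac{i-j}{2}+c_2\in[0,\mathsf K)$ is an IC-net, and its quadrilateral with vertices $(i,j),(i+1,j),(i+1,j+1),(i,j+1)$ has an incircle centered at the untransformed point $\boldsymbol x\big(\frac{i+j+1+\varepsilon}2,\frac{i-j}2\big)$. -/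

import Mathlib

noncomputable section

/-- The Euclidean plane. -/
abbrev Plane : Type := EuclideanSpace ℝ (Fin 2)

/-! Jacobi elliptic functions of a real argument, with modulus `k` (used for `0 < k ^ 2 < 1`). -/

/-- Incomplete elliptic integral of the first kind `F(φ, k)`. -/
def ellipticF (k φ : ℝ) : ℝ := ∫ θ in (0 : ℝ)..φ, 1 / √(1 - k ^ 2 * Real.sin θ ^ 2)

/-- The quarter period `K(k) = F(π/2, k)`. -/
def quarterPeriod (k : ℝ) : ℝ := ellipticF k (Real.pi / 2)

/-- The Jacobi amplitude: the inverse of the bijection `φ ↦ F(φ, k)` of the real line. -/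
def jacobiAm (s k : ℝ) : ℝ := Function.invFun (ellipticF k) s

/-- The elliptic sine. -/
def jacobiSn (s k : ℝ) : ℝ := Real.sin (jacobiAm s k)

/-- The elliptic cosine. -/
def jacobiCn (s k : ℝ) : ℝ := Real.cos (jacobiAm s k)

/-- The delta amplitude. -/
def jacobiDn (s k : ℝ) : ℝ := √(1 - k ^ 2 * jacobiSn s k ^ 2)

/-- The complementary modulus `k'`. -/
def compModulus (k : ℝ) : ℝ := √(1 - k ^ 2)

/-! Conics, tangent lines. -/

/-- The conic `x² / A + y² / B = 1`. The confocal family of `a > b` consists of the conics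
`conic (a + μ) (b + μ)`. -/
def conic (A B : ℝ) : Set Plane := {p | p 0 ^ 2 / A + p 1 ^ 2 / B = 1}

/-- `ℓ` is a straight line. -/
def IsLine (ℓ : AffineSubspace ℝ Plane) : Prop :=
  (ℓ : Set Plane).Nonempty ∧ Module.finrank ℝ ℓ.direction = 1

/-- The straight line `ℓ` is tangent to `conic A B`: it passes through a point `p` of the conic,
and the differential at `p` of the defining function of the conic vanishes along `ℓ`. -/
def IsTangentLine (ℓ : AffineSubspace ℝ Plane) (A B : ℝ) : Prop :=
  IsLine ℓ ∧ ∃ p ∈ conic A B, p ∈ ℓ ∧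
    ∀ v ∈ ℓ.direction, fderiv ℝ (fun q : Plane => q 0 ^ 2 / A + q 1 ^ 2 / B) p v = 0

/-- The ellipse `x² / A + y² / B = 1` is a member of the confocal family of `a, b`. -/
def IsConfocalEllipse (a b A B : ℝ) : Prop := ∃ μ : ℝ, -b < μ ∧ A = a + μ ∧ B = b + μ

/-! The continuous coordinate system. -/

/-- `f₁ = √(a-b) sn(s₁)`. -/
def contF₁ (a b k s : ℝ) : ℝ := √(a - b) * jacobiSn s k

/-- `g₁ = √(a-b) cn(s₁)`. -/
def contG₁ (a b k s : ℝ) : ℝ := √(a - b) * jacobiCn s k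

/-- `f₂ = (1/k) √(a-b) dn(s₂) / cn(s₂)`. -/
def contF₂ (a b k s : ℝ) : ℝ := 1 / k * √(a - b) * (jacobiDn s k / jacobiCn s k)

/-- `g₂ = (k'/k) √(a-b) / cn(s₂)`. -/
def contG₂ (a b k s : ℝ) : ℝ := compModulus k / k * √(a - b) * (1 / jacobiCn s k)

/-- The point with coordinates `(s₁, s₂)`. -/
def contPoint (a b k s₁ s₂ : ℝ) : Plane :=
  !₂[contF₁ a b k s₁ * contF₂ a b k s₂ / √(a - b), contG₁ a b k s₁ * contG₂ a b k s₂ / √(a - b)]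

/-! The discrete coordinate system. -/

/-- The lattice of half-integers `(1/2) ℤ`. -/
def halfIntegers : Set ℝ := Set.range fun p : ℤ => (p : ℝ) / 2

/-- The amplitude of `f₁`. -/
def amplA (a b k δ : ℝ) : ℝ := √((a - b) * (jacobiDn (δ / 2) k / jacobiCn (δ / 2) k))

/-- The amplitude of `g₁`. -/
def amplB (a b k δ : ℝ) : ℝ := √((a - b) / jacobiCn (δ / 2) k)

/-- Discrete `f₁`. -/
def discF₁ (a b k δ c n : ℝ) : ℝ := amplA a b k δ * jacobiSn (δ * n + c) k

/-- Discrete `g₁`. -/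
def discG₁ (a b k δ c n : ℝ) : ℝ := amplB a b k δ * jacobiCn (δ * n + c) k

/-- Discrete `f₂`. -/
def discF₂ (a b k δ c n : ℝ) : ℝ :=
  1 / k * amplA a b k δ * (jacobiDn (δ * n + c) k / jacobiCn (δ * n + c) k)

/-- Discrete `g₂`. -/
def discG₂ (a b k δ c n : ℝ) : ℝ :=
  compModulus k / k * amplB a b k δ * (1 / jacobiCn (δ * n + c) k)

/-- The point with discrete coordinates `(n₁, n₂)`. -/
def discPoint (a b k δ c₁ c₂ n₁ n₂ : ℝ) : Plane :=
  !₂[discF₁ a b k δ c₁ n₁ * discF₂ a b k δ c₂ n₂ / √(a - b),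
    discG₁ a b k δ c₁ n₁ * discG₂ a b k δ c₂ n₂ / √(a - b)]

/-! Incircular nets. -/

/-- The circle `S` touches the (nondegenerate, closed) segment `[A, B]`. -/
def TouchesSide (S : EuclideanGeometry.Sphere Plane) (A B : Plane) : Prop :=
  A ≠ B ∧ ∃ p ∈ segment ℝ A B, S.IsTangentAt p (AffineSubspace.mk' A (ℝ ∙ (B -ᵥ A)))

/-- `S` is an incircle of the quadrilateral `ABCD`: a circle of positive radius that touches the
four sides. -/
def IsIncircle (S : EuclideanGeometry.Sphere Plane) (A B C D : Plane) : Prop :=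
  0 < S.radius ∧ TouchesSide S A B ∧ TouchesSide S B C ∧ TouchesSide S C D ∧ TouchesSide S D A

/-- The four corners of the elementary square with lower left corner `(i, j)` are in `U`. -/
def SquareIn (U : Set (ℤ × ℤ)) (i j : ℤ) : Prop :=
  (i, j) ∈ U ∧ (i + 1, j) ∈ U ∧ (i + 1, j + 1) ∈ U ∧ (i, j + 1) ∈ U

/-- An incircular net (IC-net) on a domain `U ⊆ ℤ²`: the points `h(i, ·)` lie on a straight line
in their natural order, so do the points `h(·, j)`, and every elementary quadrilateral is
circumscribed about a circle. -/
structure IsICNet (U : Set (ℤ × ℤ)) (h : ℤ → ℤ → Plane) : Prop where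
  line_left : ∀ i, ∃ ℓ, IsLine ℓ ∧ ∀ j, (i, j) ∈ U → h i j ∈ ℓ
  line_right : ∀ j, ∃ ℓ, IsLine ℓ ∧ ∀ i, (i, j) ∈ U → h i j ∈ ℓ
  order_left : ∀ i j, (i, j - 1) ∈ U → (i, j) ∈ U → (i, j + 1) ∈ U →
    Sbtw ℝ (h i (j - 1)) (h i j) (h i (j + 1))
  order_right : ∀ i j, (i - 1, j) ∈ U → (i, j) ∈ U → (i + 1, j) ∈ U →
    Sbtw ℝ (h (i - 1) j) (h i j) (h (i + 1) j)
  circumscribed : ∀ i j, SquareIn U i j →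
    ∃ S, IsIncircle S (h i j) (h (i + 1) j) (h (i + 1) (j + 1)) (h i (j + 1))

/-- The diagonal nets of the discrete coordinate system. For `ε = 0` and `ε = 1` the pairs
`((i + j + ε) / 2, (i - j) / 2)` exhaust the two halves of the lattice `((1/2) ℤ)²`, those with
`n₁ + n₂ ∈ ℤ` and those with `n₁ + n₂ ∈ ℤ + 1/2`. Along `i = const` the sum `n₁ + n₂` is constant,
along `j = const` the difference `n₁ - n₂` is. -/
def diagNet (a b k δ c₁ c₂ : ℝ) (ε i j : ℤ) : Plane :=
  discPoint a b k δ c₁ c₂ (((i : ℝ) + j + ε) / 2) (((i : ℝ) - j) / 2)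

/-- The domain of the diagonal nets: the argument `s₂ = δ n₂ + c₂` lies in `[0, K(k))`. -/
def diagDomain (k δ c₂ : ℝ) : Set (ℤ × ℤ) :=
  {ij | δ * (((ij.1 : ℝ) - ij.2) / 2) + c₂ ∈ Set.Ico 0 (quarterPeriod k)}

end

open Real

theorem sq_mul_sin_sq_lt_one {k : ℝ} (hk : k ^ 2 < 1) (θ : ℝ) : k ^ 2 * sin θ ^ 2 < 1 := by
  nlinarith [sin_sq_le_one θ, sq_nonneg (sin θ), sq_nonneg k]

theorem continuous_ellipticF_integrand {k : ℝ} (hk : k ^ 2 < 1) :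
    Continuous fun θ : ℝ => 1 / √(1 - k ^ 2 * sin θ ^ 2) := by
  refine continuous_const.div (by fun_prop) fun θ => ?_
  have := sq_mul_sin_sq_lt_one hk θ
  exact (sqrt_pos.2 (by linarith)).ne'

theorem hasDerivAt_ellipticF {k : ℝ} (hk : k ^ 2 < 1) (φ : ℝ) :
    HasDerivAt (ellipticF k) (1 / √(1 - k ^ 2 * sin φ ^ 2)) φ :=
  (continuous_ellipticF_integrand hk).integral_hasStrictDerivAt 0 φ |>.hasDerivAt

theorem one_le_deriv_ellipticF {k : ℝ} (hk : k ^ 2 < 1) (φ : ℝ) :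
    1 ≤ 1 / √(1 - k ^ 2 * sin φ ^ 2) := by
  have := sq_mul_sin_sq_lt_one hk φ
  rw [le_div_iff₀ (sqrt_pos.2 (by linarith)), one_mul]
  exact sqrt_le_one.2 (by nlinarith [mul_nonneg (sq_nonneg k) (sq_nonneg (sin φ))])

theorem ellipticF_zero (k : ℝ) : ellipticF k 0 = 0 := by simp [ellipticF]

theorem ellipticF_neg (k φ : ℝ) : ellipticF k (-φ) = -ellipticF k φ := by
  have h := intervalIntegral.integral_comp_neg (a := 0) (b := φ)
    (fun θ : ℝ => 1 / √(1 - k ^ 2 * sin θ ^ 2))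
  simp only [sin_neg, neg_sq, neg_zero] at h
  rw [ellipticF, ellipticF, h, ← intervalIntegral.integral_symm]

theorem monotone_ellipticF_sub_id {k : ℝ} (hk : k ^ 2 < 1) :
    Monotone fun φ => ellipticF k φ - φ := by
  have h (φ : ℝ) := (hasDerivAt_ellipticF hk φ).sub (hasDerivAt_id φ)
  refine monotone_of_deriv_nonneg (fun φ => (h φ).differentiableAt) fun φ => ?_
  have e := (h φ).deriv
  have := one_le_deriv_ellipticF hk φ
  change 0 ≤ deriv (ellipticF k - id) φ
  rw [e]
  linarith

theorem strictMono_ellipticF {k : ℝ} (hk : k ^ 2 < 1) : StrictMono (ellipticF k) := by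
  intro x y hxy
  have := monotone_ellipticF_sub_id hk hxy.le
  simp only at this
  linarith

theorem surjective_ellipticF {k : ℝ} (hk : k ^ 2 < 1) : Function.Surjective (ellipticF k) := by
  have hc : Continuous (ellipticF k) :=
    continuous_iff_continuousAt.2 fun φ => (hasDerivAt_ellipticF hk φ).continuousAt
  refine hc.surjective ?_ ?_
  · refine Filter.tendsto_atTop_mono' _ ?_ Filter.tendsto_id
    filter_upwards [Filter.eventually_ge_atTop 0] with φ hφ
    have := monotone_ellipticF_sub_id hk hφ
    simp only [ellipticF_zero] at this
    simp only [id]; linarith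
  · refine Filter.tendsto_atBot_mono' _ ?_ Filter.tendsto_id
    filter_upwards [Filter.eventually_le_atBot 0] with φ hφ
    have := monotone_ellipticF_sub_id hk hφ
    simp only [ellipticF_zero] at this
    simp only [id]; linarith

theorem ellipticF_jacobiAm {k : ℝ} (hk : k ^ 2 < 1) (s : ℝ) : ellipticF k (jacobiAm s k) = s :=
  Function.rightInverse_invFun (surjective_ellipticF hk) s

theorem jacobiAm_ellipticF {k : ℝ} (hk : k ^ 2 < 1) (φ : ℝ) : jacobiAm (ellipticF k φ) k = φ :=
  Function.leftInverse_invFun (strictMono_ellipticF hk).injective φ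

theorem strictMono_jacobiAm {k : ℝ} (hk : k ^ 2 < 1) : StrictMono fun s => jacobiAm s k := by
  intro s t hst
  rw [← (strictMono_ellipticF hk).lt_iff_lt]
  simpa only [ellipticF_jacobiAm hk] using hst

theorem jacobiAm_zero {k : ℝ} (hk : k ^ 2 < 1) : jacobiAm 0 k = 0 := by
  conv_lhs => rw [← ellipticF_zero k]
  exact jacobiAm_ellipticF hk 0

theorem jacobiAm_neg {k : ℝ} (hk : k ^ 2 < 1) (s : ℝ) : jacobiAm (-s) k = -jacobiAm s k := by
  apply (strictMono_ellipticF hk).injective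
  rw [ellipticF_neg, ellipticF_jacobiAm hk, ellipticF_jacobiAm hk]

theorem jacobiAm_quarterPeriod {k : ℝ} (hk : k ^ 2 < 1) : jacobiAm (quarterPeriod k) k = π / 2 :=
  jacobiAm_ellipticF hk _

theorem hasDerivAt_jacobiAm {k : ℝ} (hk : k ^ 2 < 1) (s : ℝ) :
    HasDerivAt (fun s => jacobiAm s k) (jacobiDn s k) s := by
  have hc : Continuous fun s => jacobiAm s k :=
    (strictMono_jacobiAm hk).monotone.continuous_of_surjective
      fun φ => ⟨_, jacobiAm_ellipticF hk φ⟩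
  have hpos := one_le_deriv_ellipticF hk (jacobiAm s k)
  have h := HasDerivAt.of_local_left_inverse hc.continuousAt
    (hasDerivAt_ellipticF hk (jacobiAm s k)) (by linarith)
    (.of_forall fun t => ellipticF_jacobiAm hk t)
  simpa [jacobiDn, jacobiSn] using h

theorem jacobiDn_pos {k : ℝ} (hk : k ^ 2 < 1) (s : ℝ) : 0 < jacobiDn s k :=
  sqrt_pos.2 (sub_pos.2 (sq_mul_sin_sq_lt_one hk _))

theorem jacobiCn_sq (k s : ℝ) : jacobiCn s k ^ 2 = 1 - jacobiSn s k ^ 2 :=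
  cos_sq' _

theorem jacobiDn_sq {k : ℝ} (hk : k ^ 2 < 1) (s : ℝ) :
    jacobiDn s k ^ 2 = 1 - k ^ 2 * jacobiSn s k ^ 2 :=
  sq_sqrt (sub_nonneg.2 (sq_mul_sin_sq_lt_one hk _).le)

theorem jacobiSn_zero {k : ℝ} (hk : k ^ 2 < 1) : jacobiSn 0 k = 0 := by
  simp [jacobiSn, jacobiAm_zero hk]

theorem jacobiCn_zero {k : ℝ} (hk : k ^ 2 < 1) : jacobiCn 0 k = 1 := by
  simp [jacobiCn, jacobiAm_zero hk]

theorem jacobiDn_zero {k : ℝ} (hk : k ^ 2 < 1) : jacobiDn 0 k = 1 := by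
  simp [jacobiDn, jacobiSn_zero hk]

theorem jacobiSn_neg {k : ℝ} (hk : k ^ 2 < 1) (s : ℝ) : jacobiSn (-s) k = -jacobiSn s k := by
  simp [jacobiSn, jacobiAm_neg hk]

theorem jacobiCn_neg {k : ℝ} (hk : k ^ 2 < 1) (s : ℝ) : jacobiCn (-s) k = jacobiCn s k := by
  simp [jacobiCn, jacobiAm_neg hk]

theorem jacobiDn_neg {k : ℝ} (hk : k ^ 2 < 1) (s : ℝ) : jacobiDn (-s) k = jacobiDn s k := by
  simp [jacobiDn, jacobiSn_neg hk]

theorem hasDerivAt_jacobiSn {k : ℝ} (hk : k ^ 2 < 1) (s : ℝ) :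
    HasDerivAt (fun s => jacobiSn s k) (jacobiCn s k * jacobiDn s k) s :=
  (hasDerivAt_jacobiAm hk s).sin

theorem hasDerivAt_jacobiCn {k : ℝ} (hk : k ^ 2 < 1) (s : ℝ) :
    HasDerivAt (fun s => jacobiCn s k) (-jacobiSn s k * jacobiDn s k) s :=
  (hasDerivAt_jacobiAm hk s).cos

theorem hasDerivAt_jacobiDn {k : ℝ} (hk : k ^ 2 < 1) (s : ℝ) :
    HasDerivAt (fun s => jacobiDn s k) (-k ^ 2 * jacobiSn s k * jacobiCn s k) s := by
  have hd := jacobiDn_pos hk s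
  have h := ((((hasDerivAt_jacobiSn hk s).pow 2).const_mul (k ^ 2)).const_sub 1).sqrt
    (by simpa [jacobiDn_sq hk] using (jacobiDn_sq hk s ▸ (pow_pos hd 2)).ne')
  refine h.congr_deriv ?_
  change _ / (2 * jacobiDn s k) = _
  field_simp
  simp
  ring

theorem jacobiCn_pos_of_abs_lt {k s : ℝ} (hk : k ^ 2 < 1) (hs : |s| < quarterPeriod k) :
    0 < jacobiCn s k := by
  obtain ⟨h₁, h₂⟩ := abs_lt.1 hs
  have i₁ := strictMono_jacobiAm hk h₁
  have i₂ := strictMono_jacobiAm hk h₂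
  simp only [jacobiAm_neg hk, jacobiAm_quarterPeriod hk] at i₁ i₂
  exact cos_pos_of_mem_Ioo ⟨i₁, i₂⟩

theorem jacobiSn_pos {k s : ℝ} (hk : k ^ 2 < 1) (h₀ : 0 < s) (hs : s < quarterPeriod k) :
    0 < jacobiSn s k := by
  have i₁ := strictMono_jacobiAm hk h₀
  have i₂ := strictMono_jacobiAm hk hs
  simp only [jacobiAm_zero hk, jacobiAm_quarterPeriod hk] at i₁ i₂
  exact sin_pos_of_pos_of_lt_pi i₁ (by linarith [pi_pos])

theorem jacobiSn_nonneg {k s : ℝ} (hk : k ^ 2 < 1) (h₀ : 0 ≤ s) (hs : s < quarterPeriod k) :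
    0 ≤ jacobiSn s k := by
  rcases h₀.eq_or_lt with rfl | h₀
  · rw [jacobiSn_zero hk]
  · exact (jacobiSn_pos hk h₀ hs).le

theorem jacobiSn_ne_zero {k s : ℝ} (hk : k ^ 2 < 1) (h₀ : s ≠ 0) (hs : |s| < quarterPeriod k) :
    jacobiSn s k ≠ 0 := by
  obtain ⟨h₁, h₂⟩ := abs_lt.1 hs
  rcases h₀.lt_or_gt with h | h
  · have := jacobiSn_pos hk (neg_pos.2 h) (by linarith)
    rw [jacobiSn_neg hk] at this
    linarith
  · exact (jacobiSn_pos hk h h₂).ne'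

theorem one_sub_sq_mul_jacobiSn_sq_pos {k : ℝ} (hk : k ^ 2 < 1) (s t : ℝ) :
    0 < 1 - k ^ 2 * jacobiSn s k ^ 2 * jacobiSn t k ^ 2 := by
  have h₁ := pow_pos (jacobiDn_pos hk s) 2
  rw [jacobiDn_sq hk] at h₁
  nlinarith [jacobiCn_sq k t, sq_nonneg (jacobiCn t k), sq_nonneg (k * jacobiSn s k)]

/-- A function of `s` and `c - s` of the form `N / D` whose derivative in `s` vanishes takes the
same value at `s = c`. -/
theorem div_eq_of_hasDerivAt {N D N' D' : ℝ → ℝ} (hN : ∀ s, HasDerivAt N (N' s) s)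
    (hD : ∀ s, HasDerivAt D (D' s) s) (h₀ : ∀ s, D s ≠ 0) (h : ∀ s, N' s * D s = N s * D' s)
    (s t : ℝ) : N s / D s = N t / D t := by
  have hd (s : ℝ) : HasDerivAt (fun s => N s / D s) 0 s := by
    have := (hN s).fun_div (hD s) (h₀ s)
    rwa [h s, sub_self, zero_div] at this
  exact is_const_of_deriv_eq_zero (fun s => (hd s).differentiableAt) (fun s => (hd s).deriv) s t

section Addition

variable {k : ℝ} (hk : k ^ 2 < 1)
include hk

theorem hasDerivAt_add_denominator (c s : ℝ) :
    HasDerivAt (fun s => 1 - k ^ 2 * jacobiSn s k ^ 2 * jacobiSn (c - s) k ^ 2)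
      (-k ^ 2 * (2 * jacobiSn s k * jacobiCn s k * jacobiDn s k * jacobiSn (c - s) k ^ 2 -
        jacobiSn s k ^ 2 * (2 * jacobiSn (c - s) k * jacobiCn (c - s) k * jacobiDn (c - s) k)))
      s := by
  have hs := hasDerivAt_jacobiSn hk s
  have ht := (hasDerivAt_jacobiSn hk (c - s)).comp_const_sub c s
  refine ((((hs.fun_pow 2).const_mul (k ^ 2)).fun_mul (ht.fun_pow 2)).const_sub 1).congr_deriv ?_
  push_cast
  ring

theorem jacobiSn_add (x y : ℝ) : jacobiSn (x + y) k =
    (jacobiSn x k * jacobiCn y k * jacobiDn y k + jacobiSn y k * jacobiCn x k * jacobiDn x k) /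
      (1 - k ^ 2 * jacobiSn x k ^ 2 * jacobiSn y k ^ 2) := by
  have key := div_eq_of_hasDerivAt (fun s =>
      (((hasDerivAt_jacobiSn hk s).fun_mul
        ((hasDerivAt_jacobiCn hk (x + y - s)).comp_const_sub (x + y) s)).fun_mul
          ((hasDerivAt_jacobiDn hk (x + y - s)).comp_const_sub (x + y) s)).fun_add
      ((((hasDerivAt_jacobiSn hk (x + y - s)).comp_const_sub (x + y) s).fun_mul
        (hasDerivAt_jacobiCn hk s)).fun_mul (hasDerivAt_jacobiDn hk s)))
    (hasDerivAt_add_denominator hk (x + y))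
    (fun s => (one_sub_sq_mul_jacobiSn_sq_pos hk s (x + y - s)).ne') (fun s => by
      have h₁ := jacobiCn_sq k s
      have h₂ := jacobiDn_sq hk s
      have h₃ := jacobiCn_sq k (x + y - s)
      have h₄ := jacobiDn_sq hk (x + y - s)
      generalize jacobiSn s k = sx, jacobiCn s k = cx, jacobiDn s k = dx,
        jacobiSn (x + y - s) k = sy, jacobiCn (x + y - s) k = cy,
        jacobiDn (x + y - s) k = dy at *
      grind) (x + y) x
  simpa [jacobiSn_zero hk, jacobiCn_zero hk, jacobiDn_zero hk] using key

theorem jacobiCn_add (x y : ℝ) : jacobiCn (x + y) k =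
    (jacobiCn x k * jacobiCn y k - jacobiSn x k * jacobiSn y k * jacobiDn x k * jacobiDn y k) /
      (1 - k ^ 2 * jacobiSn x k ^ 2 * jacobiSn y k ^ 2) := by
  have key := div_eq_of_hasDerivAt (fun s =>
      ((hasDerivAt_jacobiCn hk s).fun_mul
        ((hasDerivAt_jacobiCn hk (x + y - s)).comp_const_sub (x + y) s)).fun_sub
      ((((hasDerivAt_jacobiSn hk s).fun_mul
        ((hasDerivAt_jacobiSn hk (x + y - s)).comp_const_sub (x + y) s)).fun_mul
        (hasDerivAt_jacobiDn hk s)).fun_mul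
          ((hasDerivAt_jacobiDn hk (x + y - s)).comp_const_sub (x + y) s)))
    (hasDerivAt_add_denominator hk (x + y))
    (fun s => (one_sub_sq_mul_jacobiSn_sq_pos hk s (x + y - s)).ne') (fun s => by
      have h₁ := jacobiCn_sq k s
      have h₂ := jacobiDn_sq hk s
      have h₃ := jacobiCn_sq k (x + y - s)
      have h₄ := jacobiDn_sq hk (x + y - s)
      generalize jacobiSn s k = sx, jacobiCn s k = cx, jacobiDn s k = dx,
        jacobiSn (x + y - s) k = sy, jacobiCn (x + y - s) k = cy,
        jacobiDn (x + y - s) k = dy at *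
      grind) (x + y) x
  simpa [jacobiSn_zero hk, jacobiCn_zero hk, jacobiDn_zero hk] using key

theorem jacobiDn_add (x y : ℝ) : jacobiDn (x + y) k =
    (jacobiDn x k * jacobiDn y k -
        k ^ 2 * (jacobiSn x k * jacobiSn y k * jacobiCn x k * jacobiCn y k)) /
      (1 - k ^ 2 * jacobiSn x k ^ 2 * jacobiSn y k ^ 2) := by
  have key := div_eq_of_hasDerivAt (fun s =>
      ((hasDerivAt_jacobiDn hk s).fun_mul
        ((hasDerivAt_jacobiDn hk (x + y - s)).comp_const_sub (x + y) s)).fun_sub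
      (((((hasDerivAt_jacobiSn hk s).fun_mul
        ((hasDerivAt_jacobiSn hk (x + y - s)).comp_const_sub (x + y) s)).fun_mul
        (hasDerivAt_jacobiCn hk s)).fun_mul
          ((hasDerivAt_jacobiCn hk (x + y - s)).comp_const_sub (x + y) s)).const_mul (k ^ 2)))
    (hasDerivAt_add_denominator hk (x + y))
    (fun s => (one_sub_sq_mul_jacobiSn_sq_pos hk s (x + y - s)).ne') (fun s => by
      have h₁ := jacobiCn_sq k s
      have h₂ := jacobiDn_sq hk s
      have h₃ := jacobiCn_sq k (x + y - s)
      have h₄ := jacobiDn_sq hk (x + y - s)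
      generalize jacobiSn s k = sx, jacobiCn s k = cx, jacobiDn s k = dx,
        jacobiSn (x + y - s) k = sy, jacobiCn (x + y - s) k = cy,
        jacobiDn (x + y - s) k = dy at *
      grind) (x + y) x
  simpa [jacobiSn_zero hk, jacobiCn_zero hk, jacobiDn_zero hk] using key

/-! Further forms of the addition theorem, without denominators. -/

theorem jacobiCn_add_eq (x y : ℝ) : jacobiCn (x + y) k =
    jacobiCn x k * jacobiCn y k - jacobiSn x k * jacobiSn y k * jacobiDn (x + y) k := by
  have hD := one_sub_sq_mul_jacobiSn_sq_pos hk x y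
  rw [jacobiCn_add hk, jacobiDn_add hk]
  generalize hE : 1 - k ^ 2 * jacobiSn x k ^ 2 * jacobiSn y k ^ 2 = D at hD ⊢
  field_simp
  rw [← hE]
  ring

theorem jacobiDn_add_eq (x y : ℝ) : jacobiDn (x + y) k =
    jacobiDn x k * jacobiDn y k - k ^ 2 * (jacobiSn x k * jacobiSn y k) * jacobiCn (x + y) k := by
  have hD := one_sub_sq_mul_jacobiSn_sq_pos hk x y
  rw [jacobiCn_add hk, jacobiDn_add hk]
  generalize hE : 1 - k ^ 2 * jacobiSn x k ^ 2 * jacobiSn y k ^ 2 = D at hD ⊢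
  field_simp
  rw [← hE]
  ring

theorem jacobiSn_add_mul_jacobiDn (x y : ℝ) : jacobiSn (x + y) k * jacobiDn y k =
    jacobiSn x k * jacobiCn y k + jacobiSn y k * jacobiCn x k * jacobiDn (x + y) k := by
  have hD := one_sub_sq_mul_jacobiSn_sq_pos hk x y
  rw [jacobiSn_add hk, jacobiDn_add hk]
  generalize hE : 1 - k ^ 2 * jacobiSn x k ^ 2 * jacobiSn y k ^ 2 = D at hD ⊢
  field_simp
  subst hE
  linear_combination jacobiSn x k * jacobiCn y k * jacobiDn_sq hk y +
    k ^ 2 * jacobiSn x k * jacobiSn y k ^ 2 * jacobiCn y k * jacobiCn_sq k x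

theorem jacobiSn_add_mul_jacobiCn_mul_jacobiDn (x y : ℝ) :
    jacobiSn (x + y) k * jacobiCn y k * jacobiDn x k =
      jacobiSn x k * jacobiDn (x + y) k + jacobiSn y k * jacobiCn (x + y) k := by
  have hD := one_sub_sq_mul_jacobiSn_sq_pos hk x y
  have h₁ := jacobiCn_sq k x
  have h₂ := jacobiDn_sq hk x
  have h₃ := jacobiCn_sq k y
  have h₄ := jacobiDn_sq hk y
  rw [jacobiSn_add hk, jacobiCn_add hk, jacobiDn_add hk]
  generalize hE : 1 - k ^ 2 * jacobiSn x k ^ 2 * jacobiSn y k ^ 2 = D at hD ⊢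
  field_simp
  subst hE
  clear hD
  grind

theorem jacobiCn_eq_of_add (x y : ℝ) : jacobiCn y k =
    jacobiCn (x + y) k * jacobiCn x k + jacobiSn (x + y) k * jacobiSn x k * jacobiDn y k := by
  have h := jacobiCn_add_eq hk (x + y) (-x)
  rw [add_neg_cancel_comm, jacobiSn_neg hk, jacobiCn_neg hk] at h
  linarith

theorem jacobiDn_mul_sub_jacobiCn_mul (x y : ℝ) :
    jacobiDn x k * jacobiDn y k * jacobiDn (x + y) k -
      k ^ 2 * (jacobiCn x k * jacobiCn y k * jacobiCn (x + y) k) = 1 - k ^ 2 := by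
  have hD := one_sub_sq_mul_jacobiSn_sq_pos hk x y
  have h₁ := jacobiCn_sq k x
  have h₂ := jacobiDn_sq hk x
  have h₃ := jacobiCn_sq k y
  have h₄ := jacobiDn_sq hk y
  rw [jacobiCn_add hk, jacobiDn_add hk]
  generalize hE : 1 - k ^ 2 * jacobiSn x k ^ 2 * jacobiSn y k ^ 2 = D at hD ⊢
  field_simp
  subst hE
  clear hD
  grind

theorem jacobiSn_add_mul_add (x y : ℝ) :
    jacobiSn (x + y) k * (jacobiDn x k * jacobiDn y k +
      k ^ 2 * (jacobiSn x k * jacobiSn y k) * (jacobiCn x k * jacobiCn y k)) =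
    jacobiSn x k * jacobiCn y k * jacobiDn x k + jacobiSn y k * jacobiCn x k * jacobiDn y k := by
  have hD := one_sub_sq_mul_jacobiSn_sq_pos hk x y
  have h₁ := jacobiCn_sq k x
  have h₂ := jacobiDn_sq hk x
  have h₃ := jacobiCn_sq k y
  have h₄ := jacobiDn_sq hk y
  rw [jacobiSn_add hk]
  generalize hE : 1 - k ^ 2 * jacobiSn x k ^ 2 * jacobiSn y k ^ 2 = D at hD ⊢
  field_simp
  subst hE
  clear hD
  grind

theorem jacobiSn_four_term (x y z : ℝ) :
    jacobiSn (x + y) k * (jacobiSn (z - y) k * jacobiSn (z + x) k + jacobiSn x k * jacobiSn y k) =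
      jacobiSn z k * (jacobiSn y k * jacobiSn (z - y) k + jacobiSn x k * jacobiSn (z + x) k) := by
  have hD₁ := one_sub_sq_mul_jacobiSn_sq_pos hk x y
  have hD₂ := one_sub_sq_mul_jacobiSn_sq_pos hk z y
  have hD₃ := one_sub_sq_mul_jacobiSn_sq_pos hk z x
  have h₁ := jacobiCn_sq k x
  have h₂ := jacobiDn_sq hk x
  have h₃ := jacobiCn_sq k y
  have h₄ := jacobiDn_sq hk y
  have h₅ := jacobiCn_sq k z
  have h₆ := jacobiDn_sq hk z
  rw [sub_eq_add_neg, jacobiSn_add hk, jacobiSn_add hk, jacobiSn_add hk, jacobiSn_neg hk,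
    jacobiCn_neg hk, jacobiDn_neg hk, neg_sq]
  generalize hE₁ : 1 - k ^ 2 * jacobiSn x k ^ 2 * jacobiSn y k ^ 2 = D₁ at hD₁ ⊢
  generalize hE₂ : 1 - k ^ 2 * jacobiSn z k ^ 2 * jacobiSn y k ^ 2 = D₂ at hD₂ ⊢
  generalize hE₃ : 1 - k ^ 2 * jacobiSn z k ^ 2 * jacobiSn x k ^ 2 = D₃ at hD₃ ⊢
  field_simp
  subst hE₁ hE₂ hE₃
  clear hD₁ hD₂ hD₃
  grind

end Addition

/-- The point with parameter `τ` on the tangent line of the ellipse `x² / p² + y² / q² = 1` at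
`(p X, q Y)`. -/
noncomputable def tangentPoint (p q X Y τ : ℝ) : Plane := !₂[p * (X + τ * Y), q * (Y - τ * X)]

/-- The tangent line of the ellipse `x² / p² + y² / q² = 1` at `(p X, q Y)`. -/
noncomputable def tangentLine (p q X Y : ℝ) : AffineSubspace ℝ Plane :=
  AffineSubspace.mk' !₂[p * X, q * Y] (ℝ ∙ (!₂[p * Y, -(q * X)] : Plane))

theorem tangentPoint_mem_tangentLine (p q X Y τ : ℝ) :
    tangentPoint p q X Y τ ∈ tangentLine p q X Y := by
  rw [tangentLine, AffineSubspace.mem_mk', Submodule.mem_span_singleton]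
  refine ⟨τ, ?_⟩
  ext i
  fin_cases i <;> simp [tangentPoint] <;> ring

theorem tangentPoint_sub (p q X Y σ τ : ℝ) :
    tangentPoint p q X Y τ - tangentPoint p q X Y σ =
      (τ - σ) • (!₂[p * Y, -(q * X)] : Plane) := by
  ext i
  fin_cases i <;> simp [tangentPoint] <;> ring

theorem tangent_direction_ne_zero {p q X Y : ℝ} (hp : p ≠ 0) (hq : q ≠ 0)
    (h : X ^ 2 + Y ^ 2 = 1) : (!₂[p * Y, -(q * X)] : Plane) ≠ 0 := by
  intro h0
  have h₀ := congrArg (fun v : Plane => v 0) h0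
  have h₁ := congrArg (fun v : Plane => v 1) h0
  simp [hp, hq] at h₀ h₁
  simp [h₀, h₁] at h

theorem isLine_tangentLine {p q X Y : ℝ} (hp : p ≠ 0) (hq : q ≠ 0) (h : X ^ 2 + Y ^ 2 = 1) :
    IsLine (tangentLine p q X Y) := by
  refine ⟨⟨_, AffineSubspace.self_mem_mk' _ _⟩, ?_⟩
  rw [tangentLine, AffineSubspace.direction_mk']
  exact finrank_span_singleton (tangent_direction_ne_zero hp hq h)

theorem hasFDerivAt_conic (A B : ℝ) (p : Plane) :
    HasFDerivAt (fun q : Plane => q 0 ^ 2 / A + q 1 ^ 2 / B)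
      ((2 * p 0 / A) • (EuclideanSpace.proj 0 : Plane →L[ℝ] ℝ) +
        (2 * p 1 / B) • (EuclideanSpace.proj 1 : Plane →L[ℝ] ℝ)) p := by
  have h (i : Fin 2) (C : ℝ) : HasFDerivAt (fun q : Plane => q i ^ 2 / C)
      ((2 * p i / C) • (EuclideanSpace.proj i : Plane →L[ℝ] ℝ)) p := by
    have := ((EuclideanSpace.proj i : Plane →L[ℝ] ℝ).hasFDerivAt (x := p)).pow 2 |>.mul_const C⁻¹
    simp only [div_eq_mul_inv]
    refine this.congr_fderiv ?_
    ext v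
    simp
    ring
  exact (h 0 A).add (h 1 B)

theorem isTangentLine_tangentLine {p q X Y : ℝ} (hp : p ≠ 0) (hq : q ≠ 0)
    (h : X ^ 2 + Y ^ 2 = 1) : IsTangentLine (tangentLine p q X Y) (p ^ 2) (q ^ 2) := by
  refine ⟨isLine_tangentLine hp hq h, !₂[p * X, q * Y], ?_, AffineSubspace.self_mem_mk' _ _, ?_⟩
  · simp only [conic, Set.mem_ofPred_eq, Matrix.cons_val_zero, Matrix.cons_val_one]
    field_simp
    exact h
  · intro v hv
    rw [tangentLine, AffineSubspace.direction_mk', Submodule.mem_span_singleton] at hv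
    obtain ⟨t, rfl⟩ := hv
    rw [(hasFDerivAt_conic _ _ _).fderiv]
    simp
    field_simp
    simp

theorem tangentPoint_injective {p q X Y : ℝ} (hp : p ≠ 0) (hq : q ≠ 0) (h : X ^ 2 + Y ^ 2 = 1) :
    Function.Injective (tangentPoint p q X Y) := by
  intro σ τ e
  have := tangentPoint_sub p q X Y τ σ
  rw [e, sub_self, eq_comm, smul_eq_zero] at this
  simpa [tangent_direction_ne_zero hp hq h, sub_eq_zero] using this

theorem tangentPoint_mem_segment (p q X Y : ℝ) {σ τ υ : ℝ} (hne : σ ≠ υ)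
    (h : 0 ≤ (τ - σ) * (υ - τ)) :
    tangentPoint p q X Y τ ∈ segment ℝ (tangentPoint p q X Y σ) (tangentPoint p q X Y υ) := by
  have hs : 0 < (υ - σ) ^ 2 := by positivity [sub_ne_zero.2 hne.symm]
  have hne' : υ - σ ≠ 0 := sub_ne_zero.2 hne.symm
  rw [mem_segment_iff_wbtw]
  refine ⟨(τ - σ) / (υ - σ), ⟨?_, ?_⟩, ?_⟩
  · rw [← mul_div_mul_right _ _ hne', ← sq]
    exact div_nonneg (by nlinarith [sq_nonneg (τ - σ)]) hs.le
  · rw [← mul_div_mul_right _ _ hne', ← sq, div_le_one hs]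
    nlinarith [sq_nonneg (υ - τ)]
  · rw [AffineMap.lineMap_apply, vsub_eq_sub, tangentPoint_sub, smul_smul, div_mul_cancel₀ _ hne',
      ← tangentPoint_sub, vadd_eq_add, sub_add_cancel]

theorem sbtw_tangentPoint {p q X Y : ℝ} (hp : p ≠ 0) (hq : q ≠ 0) (hXY : X ^ 2 + Y ^ 2 = 1)
    {σ τ υ : ℝ} (h : 0 < (τ - σ) * (υ - τ)) :
    Sbtw ℝ (tangentPoint p q X Y σ) (tangentPoint p q X Y τ) (tangentPoint p q X Y υ) := by
  refine ⟨mem_segment_iff_wbtw.1 (tangentPoint_mem_segment p q X Y ?_ h.le), ?_, ?_⟩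
  · rintro rfl
    nlinarith [sq_nonneg (τ - σ)]
  · exact (tangentPoint_injective hp hq hXY).ne (by rintro rfl; simp at h)
  · exact (tangentPoint_injective hp hq hXY).ne (by rintro rfl; simp at h)

theorem touchesSide_tangentPoint {p q X Y : ℝ} (hp : p ≠ 0) (hq : q ≠ 0)
    (hXY : X ^ 2 + Y ^ 2 = 1) {σ τ υ : ℝ} (hne : σ ≠ υ) (h : 0 ≤ (τ - σ) * (υ - τ))
    {S : EuclideanGeometry.Sphere Plane} {μ : ℝ}
    (hc : tangentPoint p q X Y τ = S.center + μ • (!₂[q * X, p * Y] : Plane))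
    (hr : S.radius = |μ| * √((q * X) ^ 2 + (p * Y) ^ 2)) :
    TouchesSide S (tangentPoint p q X Y σ) (tangentPoint p q X Y υ) := by
  have hvs : tangentPoint p q X Y τ -ᵥ S.center = μ • (!₂[q * X, p * Y] : Plane) := by
    rw [hc, vsub_eq_sub, add_sub_cancel_left]
  refine ⟨(tangentPoint_injective hp hq hXY).ne hne, _,
    tangentPoint_mem_segment p q X Y hne h, ?_, ?_, ?_⟩
  · rw [EuclideanGeometry.mem_sphere, dist_eq_norm_vsub Plane, hvs, norm_smul, hr,
      EuclideanSpace.norm_eq]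
    simp
  · rw [AffineSubspace.mem_mk', Submodule.mem_span_singleton]
    refine ⟨(τ - σ) / (υ - σ), ?_⟩
    rw [vsub_eq_sub, vsub_eq_sub, tangentPoint_sub, tangentPoint_sub, smul_smul,
      div_mul_cancel₀ _ (sub_ne_zero.2 hne.symm)]
  · intro x hx
    rw [AffineSubspace.mem_mk', Submodule.mem_span_singleton] at hx
    obtain ⟨t, ht⟩ := hx
    rw [EuclideanGeometry.Sphere.mem_orthRadius_iff_inner_left, hvs,
      ← vsub_sub_vsub_cancel_right x _ (tangentPoint p q X Y σ), ← ht, vsub_eq_sub, vsub_eq_sub,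
      tangentPoint_sub, tangentPoint_sub, smul_smul, ← sub_smul, inner_smul_left, inner_smul_right]
    simp [PiLp.inner_apply]
    ring_nf
    simp

/-- The affine map `(x, y) ↦ (u x, v y)`. -/
noncomputable def planeScaling (u v : ℝ) (hu : u ≠ 0) (hv : v ≠ 0) : Plane ≃ᵃ[ℝ] Plane :=
  LinearEquiv.toAffineEquiv
    { toFun := fun p => !₂[u * p 0, v * p 1]
      invFun := fun p => !₂[u⁻¹ * p 0, v⁻¹ * p 1]
      map_add' := fun p q => by ext i; fin_cases i <;> simp <;> ring
      map_smul' := fun c p => by ext i; fin_cases i <;> simp <;> ring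
      left_inv := fun p => by ext i; fin_cases i <;> simp [hu, hv]
      right_inv := fun p => by ext i; fin_cases i <;> simp [hu, hv] }

theorem planeScaling_apply {u v : ℝ} (hu : u ≠ 0) (hv : v ≠ 0) (p : Plane) :
    planeScaling u v hu hv p = !₂[u * p 0, v * p 1] := rfl

theorem compModulus_pos {k : ℝ} (hk : k ^ 2 < 1) : 0 < compModulus k :=
  sqrt_pos.2 (sub_pos.2 hk)

theorem compModulus_sq {k : ℝ} (hk : k ^ 2 < 1) : compModulus k ^ 2 = 1 - k ^ 2 :=
  sq_sqrt (sub_nonneg.2 hk.le)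

theorem contPoint_neg_right {k : ℝ} (hk : k ^ 2 < 1) (a b s₁ s₂ : ℝ) :
    contPoint a b k s₁ (-s₂) = contPoint a b k s₁ s₂ := by
  simp [contPoint, contF₂, contG₂, jacobiCn_neg hk, jacobiDn_neg hk]

/-- The coordinate on the line `s₁ - s₂ = x` of the point with `s₂ = y`. -/
noncomputable def lineCoord (k x y : ℝ) : ℝ :=
  jacobiSn y k * jacobiDn (x + y) k / jacobiCn y k

theorem contPoint_add_eq {a b k : ℝ} (hab : b < a) (hk : k ^ 2 < 1) (x : ℝ) {y : ℝ}
    (hy : jacobiCn y k ≠ 0) : contPoint a b k (x + y) y =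
      tangentPoint (√(a - b) / k) (compModulus k * (√(a - b) / k)) (jacobiSn x k) (jacobiCn x k)
        (lineCoord k x y) := by
  have hs : √(a - b) ≠ 0 := (sqrt_pos.2 (sub_pos.2 hab)).ne'
  have h₁ := jacobiSn_add_mul_jacobiDn hk x y
  have h₂ := jacobiCn_add_eq hk x y
  have e₁ : jacobiSn x k + lineCoord k x y * jacobiCn x k =
      jacobiSn (x + y) k * jacobiDn y k / jacobiCn y k := by
    rw [lineCoord, h₁]
    field_simp
  have e₂ : jacobiCn x k - lineCoord k x y * jacobiSn x k =
      jacobiCn (x + y) k / jacobiCn y k := by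
    rw [lineCoord, h₂]
    field_simp
  rw [tangentPoint, e₁, e₂]
  ext i
  fin_cases i
  · simp only [contPoint, contF₁, contF₂, Fin.zero_eta, Matrix.cons_val_zero]
    field_simp
  · simp only [contPoint, contG₁, contG₂, Fin.mk_one, Matrix.cons_val_one, Matrix.cons_val_fin_one]
    field_simp

theorem jacobi_sq_add_sq (k s : ℝ) : jacobiSn s k ^ 2 + jacobiCn s k ^ 2 = 1 := by
  rw [jacobiCn_sq]; ring

/-- The coordinate on the line `s₁ - s₂ = x` of its point of contact with the circle belonging to
the quadrilateral around `(x + h + w, w)` with half-diagonal `h`. -/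
noncomputable def contactCoord (k x h w : ℝ) : ℝ :=
  jacobiSn (h + w) k * (jacobiDn (x + (h + w)) k * jacobiDn x k +
    k ^ 2 * (jacobiSn h k * jacobiSn w k) * (jacobiCn x k * jacobiCn (x + (h + w)) k)) /
      (jacobiDn x k * jacobiCn h k * jacobiCn w k)

section

variable {k x h w : ℝ} (hk : k ^ 2 < 1) (hh : 0 < jacobiCn h k) (hw : 0 < jacobiCn w k)
include hk hh hw

theorem contactCoord_sub_lineCoord : contactCoord k x h w - lineCoord k x w =
    jacobiSn h k * (jacobiDn (x + w) k * jacobiDn (x + (h + w)) k /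
      (jacobiCn h k * jacobiDn x k)) := by
  have hd := jacobiDn_pos hk x
  have e₁ := jacobiDn_add_eq hk (x + (h + w)) (-x)
  have e₂ := jacobiCn_eq_of_add hk x (h + w)
  have e₃ := jacobiDn_add_eq hk h w
  have e₄ := jacobiCn_add_eq hk h w
  have e₅ := jacobiDn_add_eq hk (x + w) (-x)
  have e₆ := jacobiDn_add_eq hk (x + (h + w)) (-(x + w))
  have e₇ := jacobiSn_add_mul_add hk h w
  have e₈ := jacobiSn_four_term hk h w (x + w)
  rw [add_sub_cancel_right, show x + w + h = x + (h + w) by ring] at e₈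
  rw [show x + (h + w) + -(x + w) = h by ring] at e₆
  rw [add_neg_cancel_comm] at e₁ e₅
  rw [jacobiSn_neg hk, jacobiDn_neg hk] at e₁ e₅ e₆
  rw [contactCoord, lineCoord]
  field_simp
  linear_combination (-jacobiSn (h + w) k) * e₁ -
    jacobiSn (h + w) k * k ^ 2 * jacobiSn h k * jacobiSn w k * e₂ + jacobiSn (h + w) k * e₃ -
    jacobiSn (h + w) k * k ^ 2 * jacobiSn (x + (h + w)) k * jacobiSn x k * e₄ +
    jacobiSn w k * jacobiCn h k * e₅ + jacobiSn h k * jacobiCn w k * e₆ + e₇ -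
    k ^ 2 * jacobiCn h k * jacobiCn w k * e₈

theorem lineCoord_sub_contactCoord (hm : 0 < jacobiCn (h + w) k) :
    lineCoord k x (h + w) - contactCoord k x h w =
    (1 - k ^ 2) * (jacobiSn h k * jacobiSn w k * jacobiSn (h + w) k) /
      (jacobiDn x k * jacobiCn h k * jacobiCn w k * jacobiCn (h + w) k) := by
  have hd := jacobiDn_pos hk x
  have e₁ := jacobiDn_mul_sub_jacobiCn_mul hk x (h + w)
  have e₂ := jacobiCn_add_eq hk h w
  rw [contactCoord, lineCoord, ← e₁]
  field_simp
  linear_combination (-jacobiSn (h + w) k * jacobiDn (x + (h + w)) k * jacobiDn x k) * e₂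

theorem exists_lineCoord_add_sub_lineCoord (hm : 0 < jacobiCn (h + w) k)
    (hs : 0 ≤ jacobiSn w k * jacobiSn (h + w) k) (x : ℝ) :
    ∃ c > 0, lineCoord k x (h + w) - lineCoord k x w = jacobiSn h k * c := by
  have hd := jacobiDn_pos hk
  have hk' : 0 < 1 - k ^ 2 := sub_pos.2 hk
  refine ⟨jacobiDn (x + w) k * jacobiDn (x + (h + w)) k / (jacobiCn h k * jacobiDn x k) +
    (1 - k ^ 2) * (jacobiSn w k * jacobiSn (h + w) k) /
      (jacobiDn x k * jacobiCn h k * jacobiCn w k * jacobiCn (h + w) k), ?_, ?_⟩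
  · have := hd x
    have := hd (x + w)
    have := hd (x + (h + w))
    positivity
  · rw [← sub_add_sub_cancel _ (contactCoord k x h w), contactCoord_sub_lineCoord hk hh hw,
      lineCoord_sub_contactCoord hk hh hw hm]
    ring

theorem contact_nonneg (hm : 0 < jacobiCn (h + w) k)
    (hs : 0 ≤ jacobiSn w k * jacobiSn (h + w) k) (x : ℝ) :
    0 ≤ (contactCoord k x h w - lineCoord k x w) *
      (lineCoord k x (h + w) - contactCoord k x h w) := by
  have := jacobiDn_pos hk x
  have := jacobiDn_pos hk (x + w)
  have := jacobiDn_pos hk (x + (h + w))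
  have hk' : 0 < 1 - k ^ 2 := sub_pos.2 hk
  have key : 0 ≤ jacobiSn h k ^ 2 * (jacobiDn (x + w) k * jacobiDn (x + (h + w)) k /
      (jacobiCn h k * jacobiDn x k)) * ((1 - k ^ 2) * (jacobiSn w k * jacobiSn (h + w) k) /
      (jacobiDn x k * jacobiCn h k * jacobiCn w k * jacobiCn (h + w) k)) := by positivity
  rw [contactCoord_sub_lineCoord hk hh hw, lineCoord_sub_contactCoord hk hh hw hm]
  refine key.trans_eq ?_
  ring

end

/-- The centre of the incircle of the quadrilateral around `(u, w)` with half-diagonal `h`. -/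
noncomputable def incircleCenter (a b k u w h : ℝ) : Plane :=
  !₂[√(a - b) / k * (jacobiDn h k * jacobiDn w k * jacobiSn u k / (jacobiCn h k * jacobiCn w k)),
    compModulus k * (√(a - b) / k) * (jacobiCn u k / (jacobiCn h k * jacobiCn w k))]

/-- The radius of the incircle of the quadrilateral around `(u, w)` with half-diagonal `h`. -/
noncomputable def incircleRadius (a b k u w h : ℝ) : ℝ :=
  |compModulus k * (√(a - b) / k) *
    (jacobiSn h k * jacobiSn w k * jacobiDn u k / (jacobiCn h k * jacobiCn w k))|

theorem tangentPoint_contactCoord {a b k : ℝ} (hk : k ^ 2 < 1) {x u h w : ℝ}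
    (hh : 0 < jacobiCn h k) (hw : 0 < jacobiCn w k) (hu : u = x + (h + w)) :
    tangentPoint (√(a - b) / k) (compModulus k * (√(a - b) / k)) (jacobiSn x k) (jacobiCn x k)
        (contactCoord k x h w) = incircleCenter a b k u w h +
      (compModulus k * (jacobiSn h k * jacobiSn w k * jacobiDn u k) /
        (jacobiDn x k * jacobiCn h k * jacobiCn w k)) •
        (!₂[compModulus k * (√(a - b) / k) * jacobiSn x k, √(a - b) / k * jacobiCn x k] :
          Plane) := by
  have hd := jacobiDn_pos hk x
  have e₁ := jacobiDn_add_eq hk x (h + w)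
  have e₂ := jacobiCn_add_eq hk x (h + w)
  have e₃ := jacobiDn_add_eq hk h w
  have e₄ := jacobiCn_add_eq hk h w
  have e₅ := jacobiSn_add_mul_jacobiDn hk x (h + w)
  have e₆ := jacobiSn_add_mul_jacobiCn_mul_jacobiDn hk x (h + w)
  have hx := jacobiCn_sq k x
  have hk' := compModulus_sq hk
  rw [← hu] at e₁ e₂ e₅ e₆
  have c₁ : jacobiSn x k + contactCoord k x h w * jacobiCn x k =
      jacobiDn h k * jacobiDn w k * jacobiSn u k / (jacobiCn h k * jacobiCn w k) +
      compModulus k * (jacobiSn h k * jacobiSn w k * jacobiDn u k) /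
        (jacobiDn x k * jacobiCn h k * jacobiCn w k) * (compModulus k * jacobiSn x k) := by
    rw [contactCoord, ← hu]
    field_simp
    linear_combination jacobiSn u k * jacobiDn x k * e₃ - jacobiSn x k * jacobiDn x k * e₄ -
      jacobiDn x k * e₅ - jacobiSn x k * (jacobiSn h k * jacobiSn w k) * e₁ -
      k ^ 2 * (jacobiSn h k * jacobiSn w k) * e₆ +
      k ^ 2 * (jacobiSn h k * jacobiSn w k) * jacobiSn (h + w) k * jacobiCn u k * hx -
      jacobiSn h k * jacobiSn w k * jacobiDn u k * jacobiSn x k * hk'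
  have c₂ : compModulus k * (jacobiCn x k - contactCoord k x h w * jacobiSn x k) =
      compModulus k * (jacobiCn u k / (jacobiCn h k * jacobiCn w k)) +
      compModulus k * (jacobiSn h k * jacobiSn w k * jacobiDn u k) /
        (jacobiDn x k * jacobiCn h k * jacobiCn w k) * jacobiCn x k := by
    rw [contactCoord, ← hu]
    field_simp
    linear_combination compModulus k * (-jacobiCn x k * jacobiDn x k * e₄ - jacobiDn x k * e₂ -
      jacobiCn x k * (jacobiSn h k * jacobiSn w k) * e₁)
  rw [tangentPoint, c₁, mul_right_comm (compModulus k) (√(a - b) / k), c₂]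
  ext i
  fin_cases i <;> simp [incircleCenter] <;> ring

theorem TouchesSide.symm {S : EuclideanGeometry.Sphere Plane} {A B : Plane}
    (h : TouchesSide S A B) : TouchesSide S B A := by
  obtain ⟨hne, p, hp, ht⟩ := h
  refine ⟨hne.symm, p, segment_symm ℝ A B ▸ hp, ?_⟩
  have e : AffineSubspace.mk' B (ℝ ∙ (A -ᵥ B)) = AffineSubspace.mk' A (ℝ ∙ (B -ᵥ A)) := by
    have : ℝ ∙ (A -ᵥ B) = ℝ ∙ (B -ᵥ A) := by
      rw [← neg_vsub_eq_vsub_rev B A, ← Set.neg_singleton, Submodule.span_neg]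
    rw [this]
    conv_lhs => rw [← AffineSubspace.direction_mk' A (ℝ ∙ (B -ᵥ A))]
    exact AffineSubspace.mk'_eq
      (AffineSubspace.mem_mk'.2 (Submodule.mem_span_singleton_self _))
  rwa [e]

theorem incircleCenter_neg_left {k : ℝ} (hk : k ^ 2 < 1) (a b u w h : ℝ) :
    incircleCenter a b k u (-w) h = incircleCenter a b k u w h := by
  simp [incircleCenter, jacobiCn_neg hk, jacobiDn_neg hk]

theorem incircleCenter_neg_right {k : ℝ} (hk : k ^ 2 < 1) (a b u w h : ℝ) :
    incircleCenter a b k u w (-h) = incircleCenter a b k u w h := by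
  simp [incircleCenter, jacobiCn_neg hk, jacobiDn_neg hk]

theorem incircleRadius_neg_left {k : ℝ} (hk : k ^ 2 < 1) (a b u w h : ℝ) :
    incircleRadius a b k u (-w) h = incircleRadius a b k u w h := by
  simp [incircleRadius, jacobiCn_neg hk, jacobiSn_neg hk, abs_mul, abs_div]

theorem incircleRadius_neg_right {k : ℝ} (hk : k ^ 2 < 1) (a b u w h : ℝ) :
    incircleRadius a b k u w (-h) = incircleRadius a b k u w h := by
  simp [incircleRadius, jacobiCn_neg hk, jacobiSn_neg hk, abs_mul, abs_div]

section

variable {a b k : ℝ} (hab : b < a) (hk₀ : 0 < k ^ 2) (hk : k ^ 2 < 1)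
include hab hk₀

theorem semiaxis_ne_zero : √(a - b) / k ≠ 0 :=
  div_ne_zero (sqrt_pos.2 (sub_pos.2 hab)).ne' (by rintro rfl; simp at hk₀)

include hk

theorem semiaxis_ne_zero' : compModulus k * (√(a - b) / k) ≠ 0 :=
  mul_ne_zero (compModulus_pos hk).ne' (semiaxis_ne_zero hab hk₀)

/-- The side from `(u - h, w)` to `(u, h + w)` touches the incircle. -/
theorem touchesSide_contPoint {u h w : ℝ} (hh : 0 < jacobiCn h k) (hw : 0 < jacobiCn w k)
    (hm : 0 < jacobiCn (h + w) k) (hs : 0 ≤ jacobiSn w k * jacobiSn (h + w) k)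
    (h₀ : jacobiSn h k ≠ 0) :
    TouchesSide ⟨incircleCenter a b k u w h, incircleRadius a b k u w h⟩
      (contPoint a b k (u - h) w) (contPoint a b k u (h + w)) := by
  obtain ⟨x, rfl⟩ : ∃ x, u = x + (h + w) := ⟨u - (h + w), by ring⟩
  have hd := jacobiDn_pos hk x
  rw [show x + (h + w) - h = x + w by ring, contPoint_add_eq hab hk x hw.ne',
    contPoint_add_eq hab hk x hm.ne']
  obtain ⟨c, hc, e⟩ := exists_lineCoord_add_sub_lineCoord hk hh hw hm hs x
  refine touchesSide_tangentPoint (semiaxis_ne_zero hab hk₀) (semiaxis_ne_zero' hab hk₀ hk)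
    (jacobi_sq_add_sq k x) ?_ (contact_nonneg hk hh hw hm hs x)
    (tangentPoint_contactCoord hk hh hw rfl) ?_
  · rw [ne_comm, ← sub_ne_zero, e]
    exact mul_ne_zero h₀ hc.ne'
  · have hq : (compModulus k * (√(a - b) / k) * jacobiSn x k) ^ 2 +
        (√(a - b) / k * jacobiCn x k) ^ 2 = (√(a - b) / k * jacobiDn x k) ^ 2 := by
      linear_combination (√(a - b) / k) ^ 2 * (jacobiSn x k ^ 2 * compModulus_sq hk +
        jacobiCn_sq k x - jacobiDn_sq hk x)
    rw [hq, sqrt_sq_eq_abs, ← abs_mul, incircleRadius]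
    field_simp

theorem sbtw_contPoint {x y h : ℝ} (h₀ : jacobiSn h k ≠ 0) (hh : 0 < jacobiCn h k)
    (hy₁ : 0 < jacobiCn (y - h) k) (hy₂ : 0 < jacobiCn y k) (hy₃ : 0 < jacobiCn (y + h) k)
    (hs₁ : 0 ≤ jacobiSn (y - h) k * jacobiSn y k) (hs₂ : 0 ≤ jacobiSn y k * jacobiSn (y + h) k) :
    Sbtw ℝ (contPoint a b k (x + (y - h)) (y - h)) (contPoint a b k (x + y) y)
      (contPoint a b k (x + (y + h)) (y + h)) := by
  rw [contPoint_add_eq hab hk x hy₁.ne', contPoint_add_eq hab hk x hy₂.ne',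
    contPoint_add_eq hab hk x hy₃.ne']
  refine sbtw_tangentPoint (semiaxis_ne_zero hab hk₀) (semiaxis_ne_zero' hab hk₀ hk)
    (jacobi_sq_add_sq k x) ?_
  obtain ⟨c, hc, e⟩ := exists_lineCoord_add_sub_lineCoord (w := y - h) hk hh hy₁
    (by rwa [add_sub_cancel]) (by rwa [add_sub_cancel]) x
  obtain ⟨d, hd, f⟩ := exists_lineCoord_add_sub_lineCoord (w := y) hk hh hy₂
    (by rwa [add_comm]) (by rwa [add_comm]) x
  rw [add_sub_cancel] at e
  rw [add_comm] at f
  rw [e, f]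
  have : 0 < jacobiSn h k ^ 2 * (c * d) := by positivity
  linarith

theorem isIncircle_contPoint {u h w : ℝ} (h₀ : h ≠ 0) (hw₁ : 0 ≤ w - h) (hw₂ : 0 ≤ w + h)
    (hw₃ : w - h < quarterPeriod k) (hw₄ : w + h < quarterPeriod k) :
    IsIncircle ⟨incircleCenter a b k u w h, incircleRadius a b k u w h⟩
      (contPoint a b k (u - h) w) (contPoint a b k u (w + h)) (contPoint a b k (u + h) w)
      (contPoint a b k u (w - h)) := by
  have hpos : 0 < w := by
    rcases h₀.lt_or_gt with h' | h' <;> linarith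
  have hK : |h| < quarterPeriod k := by rw [abs_lt]; constructor <;> linarith
  have hcn {s : ℝ} (h₁ : 0 ≤ s) (h₂ : s < quarterPeriod k) : 0 < jacobiCn s k :=
    jacobiCn_pos_of_abs_lt hk (by rwa [abs_of_nonneg h₁])
  have hh := jacobiCn_pos_of_abs_lt hk hK
  have hsh := jacobiSn_ne_zero hk h₀ hK
  have hsw := jacobiSn_pos hk hpos (by linarith)
  have hw := hcn hpos.le (by linarith)
  have c₁ := hcn hw₁ hw₃
  have c₂ := hcn hw₂ hw₄
  have s₁ := mul_nonneg hsw.le (jacobiSn_nonneg hk hw₁ hw₃)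
  have s₂ := mul_nonneg hsw.le (jacobiSn_nonneg hk hw₂ hw₄)
  refine ⟨?_, ?_, TouchesSide.symm ?_, ?_, TouchesSide.symm ?_⟩
  · have := semiaxis_ne_zero' hab hk₀ hk
    have := jacobiDn_pos hk u
    simp only [incircleRadius]
    positivity
  · rw [add_comm w h]
    exact touchesSide_contPoint hab hk₀ hk hh hw (by rwa [add_comm]) (by rwa [add_comm h]) hsh
  · have := touchesSide_contPoint (u := u) (h := -h) (w := -w) hab hk₀ hk (by rwa [jacobiCn_neg hk])
      (by rwa [jacobiCn_neg hk]) (by rwa [← neg_add, jacobiCn_neg hk, add_comm])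
      (by rwa [← neg_add, jacobiSn_neg hk, jacobiSn_neg hk, neg_mul_neg, add_comm h])
      (by rwa [jacobiSn_neg hk, neg_ne_zero])
    rwa [incircleCenter_neg_left hk, incircleCenter_neg_right hk, incircleRadius_neg_left hk,
      incircleRadius_neg_right hk, ← neg_add, contPoint_neg_right hk, contPoint_neg_right hk,
      sub_neg_eq_add, add_comm h] at this
  · have := touchesSide_contPoint (u := u) (h := -h) (w := w) hab hk₀ hk (by rwa [jacobiCn_neg hk])
      hw (by rwa [neg_add_eq_sub]) (by rwa [neg_add_eq_sub])
      (by rwa [jacobiSn_neg hk, neg_ne_zero])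
    rwa [incircleCenter_neg_right hk, incircleRadius_neg_right hk, sub_neg_eq_add,
      neg_add_eq_sub] at this
  · have := touchesSide_contPoint (u := u) (h := h) (w := -w) hab hk₀ hk hh
      (by rwa [jacobiCn_neg hk]) (by rwa [← sub_eq_add_neg, ← neg_sub, jacobiCn_neg hk])
      (by rwa [← sub_eq_add_neg, ← neg_sub w h, jacobiSn_neg hk, jacobiSn_neg hk, neg_mul_neg]) hsh
    rwa [incircleCenter_neg_left hk, incircleRadius_neg_left hk, ← sub_eq_add_neg, ← neg_sub w h,
      contPoint_neg_right hk, contPoint_neg_right hk] at this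

end

theorem isConfocalEllipse_of_sub_eq {a b A B : ℝ} (hB : 0 < B) (h : A - B = a - b) :
    IsConfocalEllipse a b A B :=
  ⟨B - b, by linarith, by linarith, by ring⟩

section

variable {a b k : ℝ} (hab : b < a)

include hab

theorem contF₁_sq_add_contG₁_sq (s : ℝ) : contF₁ a b k s ^ 2 + contG₁ a b k s ^ 2 = a - b := by
  rw [contF₁, contG₁, mul_pow, mul_pow, ← mul_add, jacobi_sq_add_sq, sq_sqrt (by linarith),
    mul_one]

variable (hk₀ : 0 < k ^ 2) (hk : k ^ 2 < 1)

include hk₀ hk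

theorem contF₂_sq_sub_contG₂_sq {s : ℝ} (hs : jacobiCn s k ≠ 0) :
    contF₂ a b k s ^ 2 - contG₂ a b k s ^ 2 = a - b := by
  have hk1 : k ≠ 0 := by rintro rfl; simp at hk₀
  have h : √(a - b) ^ 2 = a - b := sq_sqrt (by linarith)
  rw [contF₂, contG₂]
  field_simp
  linear_combination (a - b) * (jacobiDn_sq hk s - compModulus_sq hk - k ^ 2 * jacobiCn_sq k s) +
    (jacobiDn s k ^ 2 - compModulus k ^ 2) * h

omit hk₀ in
theorem amplA_sq {δ : ℝ} (hδ : 0 < jacobiCn (δ / 2) k) :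
    amplA a b k δ ^ 2 = (a - b) * (jacobiDn (δ / 2) k / jacobiCn (δ / 2) k) :=
  sq_sqrt (mul_nonneg (by linarith) (div_nonneg (jacobiDn_pos hk _).le hδ.le))

omit hk₀ hk in
theorem amplB_sq {δ : ℝ} (hδ : 0 < jacobiCn (δ / 2) k) :
    amplB a b k δ ^ 2 = (a - b) / jacobiCn (δ / 2) k :=
  sq_sqrt (div_nonneg (by linarith) hδ.le)

omit hk₀ in
theorem discF₁_mul_add_discG₁_mul {δ : ℝ} (hδ : 0 < jacobiCn (δ / 2) k) (c n : ℝ) :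
    discF₁ a b k δ c n * discF₁ a b k δ c (n + 1 / 2) +
      discG₁ a b k δ c n * discG₁ a b k δ c (n + 1 / 2) = a - b := by
  have hA := amplA_sq hab hk hδ
  have hB := amplB_sq (k := k) hab hδ
  have h := jacobiCn_eq_of_add hk (δ * n + c) (δ / 2)
  rw [show δ * n + c + δ / 2 = δ * (n + 1 / 2) + c by ring] at h
  rw [discF₁, discG₁, discF₁, discG₁]
  field_simp at hA hB
  apply mul_right_cancel₀ hδ.ne'
  linear_combination jacobiSn (δ * n + c) k * jacobiSn (δ * (n + 1 / 2) + c) k * hA +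
    jacobiCn (δ * n + c) k * jacobiCn (δ * (n + 1 / 2) + c) k * hB - (a - b) * h

theorem discF₂_mul_sub_discG₂_mul {δ : ℝ} (hδ : 0 < jacobiCn (δ / 2) k) {c n : ℝ}
    (h₁ : jacobiCn (δ * n + c) k ≠ 0) (h₂ : jacobiCn (δ * (n + 1 / 2) + c) k ≠ 0) :
    discF₂ a b k δ c n * discF₂ a b k δ c (n + 1 / 2) -
      discG₂ a b k δ c n * discG₂ a b k δ c (n + 1 / 2) = a - b := by
  have hk1 : k ≠ 0 := by rintro rfl; simp at hk₀
  have hA := amplA_sq hab hk hδ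
  have hB := amplB_sq (k := k) hab hδ
  have h := jacobiDn_mul_sub_jacobiCn_mul hk (δ * n + c) (δ / 2)
  have hk' := compModulus_sq hk
  rw [show δ * n + c + δ / 2 = δ * (n + 1 / 2) + c by ring] at h
  rw [discF₂, discG₂, discF₂, discG₂]
  generalize jacobiCn (δ * n + c) k = c₁, jacobiCn (δ * (n + 1 / 2) + c) k = c₂,
    jacobiDn (δ * n + c) k = d₁, jacobiDn (δ * (n + 1 / 2) + c) k = d₂ at *
  field_simp at hA hB ⊢
  apply mul_right_cancel₀ hδ.ne'
  linear_combination d₁ * d₂ * hA - compModulus k ^ 2 * hB + (a - b) * (h - hk')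

omit hk₀ in
/-- The discrete coordinate system is the affine image of the continuous one. -/
theorem discPoint_eq {δ : ℝ} (hδ : 0 < jacobiCn (δ / 2) k) (c₁ c₂ n₁ n₂ : ℝ) :
    discPoint a b k δ c₁ c₂ n₁ n₂ =
      !₂[jacobiDn (δ / 2) k / jacobiCn (δ / 2) k * contPoint a b k (δ * n₁ + c₁) (δ * n₂ + c₂) 0,
        1 / jacobiCn (δ / 2) k * contPoint a b k (δ * n₁ + c₁) (δ * n₂ + c₂) 1] := by
  have hA := amplA_sq hab hk hδ
  have hB := amplB_sq (k := k) hab hδ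
  have h : √(a - b) ^ 2 = a - b := sq_sqrt (by linarith)
  have e₁ : amplA a b k δ * amplA a b k δ =
    √(a - b) * √(a - b) * (jacobiDn (δ / 2) k / jacobiCn (δ / 2) k) := by rw [← sq, ← sq, hA, h]
  have e₂ : amplB a b k δ * amplB a b k δ =
    √(a - b) * √(a - b) * (1 / jacobiCn (δ / 2) k) := by rw [← sq, ← sq, hB, h]; ring
  ext i
  fin_cases i
  · simp only [discPoint, discF₁, discF₂, contPoint, contF₁, contF₂, Fin.zero_eta,
      Matrix.cons_val_zero]
    linear_combination jacobiSn (δ * n₁ + c₁) k * (1 / k) *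
      (jacobiDn (δ * n₂ + c₂) k / jacobiCn (δ * n₂ + c₂) k) / √(a - b) * e₁
  · simp only [discPoint, discG₁, discG₂, contPoint, contG₁, contG₂, Fin.mk_one,
      Matrix.cons_val_one, Matrix.cons_val_fin_one]
    linear_combination jacobiCn (δ * n₁ + c₁) k * (compModulus k / k) *
      (1 / jacobiCn (δ * n₂ + c₂) k) / √(a - b) * e₂

omit hk₀ in
theorem discPoint_eq_incircleCenter {δ : ℝ} (hδ : 0 < jacobiCn (δ / 2) k) (c₁ c₂ n₁ n₂ : ℝ) :
    discPoint a b k δ c₁ c₂ n₁ n₂ =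
      incircleCenter a b k (δ * n₁ + c₁) (δ * n₂ + c₂) (δ / 2) := by
  have h : √(a - b) ≠ 0 := (sqrt_pos.2 (sub_pos.2 hab)).ne'
  rw [discPoint_eq hab hk hδ]
  ext i
  fin_cases i
  · simp only [incircleCenter, contPoint, contF₁, contF₂, Fin.zero_eta, Matrix.cons_val_zero]
    field_simp
  · simp only [incircleCenter, contPoint, contG₁, contG₂, Fin.mk_one, Matrix.cons_val_one,
      Matrix.cons_val_fin_one]
    field_simp

omit hk₀ in
theorem discPoint_add_eq {δ : ℝ} (hδ : 0 < jacobiCn (δ / 2) k) {c₁ c₂ n₁ n₂ x y : ℝ}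
    (hp : contPoint a b k (δ * n₁ + c₁) (δ * n₂ + c₂) = contPoint a b k (x + y) y)
    (hy : jacobiCn y k ≠ 0) : discPoint a b k δ c₁ c₂ n₁ n₂ =
      tangentPoint (√(a - b) / k * (jacobiDn (δ / 2) k / jacobiCn (δ / 2) k))
        (compModulus k * (√(a - b) / k) * (1 / jacobiCn (δ / 2) k)) (jacobiSn x k) (jacobiCn x k)
        (lineCoord k x y) := by
  rw [discPoint_eq hab hk hδ, hp, contPoint_add_eq hab hk x hy]
  ext i
  fin_cases i <;> simp [tangentPoint] <;> ring

omit hk₀ in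
theorem contPoint_mem_of_sub_eq {x s₁ s₂ : ℝ} (hs : jacobiCn s₂ k ≠ 0) (h : s₁ - s₂ = x) :
    contPoint a b k s₁ s₂ ∈ tangentLine (√(a - b) / k) (compModulus k * (√(a - b) / k))
      (jacobiSn x k) (jacobiCn x k) := by
  obtain rfl : s₁ = x + s₂ := by linarith
  rw [contPoint_add_eq hab hk x hs]
  exact tangentPoint_mem_tangentLine _ _ _ _ _

omit hk₀ in
theorem contPoint_mem_of_add_eq {x s₁ s₂ : ℝ} (hs : jacobiCn s₂ k ≠ 0) (h : s₁ + s₂ = x) :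
    contPoint a b k s₁ s₂ ∈ tangentLine (√(a - b) / k) (compModulus k * (√(a - b) / k))
      (jacobiSn x k) (jacobiCn x k) := by
  rw [← contPoint_neg_right hk]
  exact contPoint_mem_of_sub_eq hab hk (by rwa [jacobiCn_neg hk]) (by rw [sub_neg_eq_add, h])

omit hk₀ in
theorem discPoint_mem_of_sub_eq {δ : ℝ} (hδ : 0 < jacobiCn (δ / 2) k) {c₁ c₂ n₁ n₂ x : ℝ}
    (hs : jacobiCn (δ * n₂ + c₂) k ≠ 0) (h : δ * n₁ + c₁ - (δ * n₂ + c₂) = x) :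
    discPoint a b k δ c₁ c₂ n₁ n₂ ∈
      tangentLine (√(a - b) / k * (jacobiDn (δ / 2) k / jacobiCn (δ / 2) k))
        (compModulus k * (√(a - b) / k) * (1 / jacobiCn (δ / 2) k)) (jacobiSn x k)
        (jacobiCn x k) := by
  rw [discPoint_add_eq hab hk hδ (x := x) (by rw [← h, sub_add_cancel]) hs]
  exact tangentPoint_mem_tangentLine _ _ _ _ _

omit hk₀ in
theorem discPoint_mem_of_add_eq {δ : ℝ} (hδ : 0 < jacobiCn (δ / 2) k) {c₁ c₂ n₁ n₂ x : ℝ}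
    (hs : jacobiCn (δ * n₂ + c₂) k ≠ 0) (h : δ * n₁ + c₁ + (δ * n₂ + c₂) = x) :
    discPoint a b k δ c₁ c₂ n₁ n₂ ∈
      tangentLine (√(a - b) / k * (jacobiDn (δ / 2) k / jacobiCn (δ / 2) k))
        (compModulus k * (√(a - b) / k) * (1 / jacobiCn (δ / 2) k)) (jacobiSn x k)
        (jacobiCn x k) := by
  rw [discPoint_add_eq hab hk hδ (x := x) (y := -(δ * n₂ + c₂))
    (by rw [contPoint_neg_right hk, ← h, add_neg_cancel_right]) (by rwa [jacobiCn_neg hk])]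
  exact tangentPoint_mem_tangentLine _ _ _ _ _

theorem isTangentLine_contLine (x : ℝ) :
    IsTangentLine (tangentLine (√(a - b) / k) (compModulus k * (√(a - b) / k)) (jacobiSn x k)
      (jacobiCn x k)) ((a - b) / k ^ 2) ((a - b) * compModulus k ^ 2 / k ^ 2) := by
  have h : √(a - b) ^ 2 = a - b := sq_sqrt (by linarith)
  convert isTangentLine_tangentLine (semiaxis_ne_zero hab hk₀) (semiaxis_ne_zero' hab hk₀ hk)
    (jacobi_sq_add_sq k x) using 1
  · rw [div_pow, h]
  · rw [mul_pow, div_pow, h]; ring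

theorem isTangentLine_discLine {δ : ℝ} (hδ : 0 < jacobiCn (δ / 2) k) (x : ℝ) :
    IsTangentLine (tangentLine (√(a - b) / k * (jacobiDn (δ / 2) k / jacobiCn (δ / 2) k))
      (compModulus k * (√(a - b) / k) * (1 / jacobiCn (δ / 2) k)) (jacobiSn x k) (jacobiCn x k))
      ((a - b) * (1 / k ^ 2) * (jacobiDn (δ / 2) k ^ 2 / jacobiCn (δ / 2) k ^ 2))
      ((a - b) * (compModulus k ^ 2 / k ^ 2) * (1 / jacobiCn (δ / 2) k ^ 2)) := by
  have h : √(a - b) ^ 2 = a - b := sq_sqrt (by linarith)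
  have hd := jacobiDn_pos hk (δ / 2)
  convert isTangentLine_tangentLine
    (mul_ne_zero (semiaxis_ne_zero hab hk₀) (div_pos hd hδ).ne')
    (mul_ne_zero (semiaxis_ne_zero' hab hk₀ hk) (one_div_pos.2 hδ).ne')
    (jacobi_sq_add_sq k x) using 1
  · rw [mul_pow, div_pow, h]; ring
  · rw [mul_pow, mul_pow, div_pow, h]; ring

end

theorem planeScaling_discPoint {a b k δ : ℝ} (hab : b < a) (hk : k ^ 2 < 1)
    (hδ : 0 < jacobiCn (δ / 2) k) {u v : ℝ} (hu : u ≠ 0) (hv : v ≠ 0)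
    (hu' : u = jacobiCn (δ / 2) k / jacobiDn (δ / 2) k) (hv' : v = jacobiCn (δ / 2) k)
    (c₁ c₂ n₁ n₂ : ℝ) : planeScaling u v hu hv (discPoint a b k δ c₁ c₂ n₁ n₂) =
      contPoint a b k (δ * n₁ + c₁) (δ * n₂ + c₂) := by
  have hd := jacobiDn_pos hk (δ / 2)
  rw [planeScaling_apply, discPoint_eq hab hk hδ, hu', hv']
  ext i
  fin_cases i <;> simp <;> field_simp

/-- The diagonal net in the continuous coordinate system. -/
noncomputable def contNet (a b k δ c₁ c₂ : ℝ) (ε i j : ℤ) : Plane :=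
  contPoint a b k (δ * (((i : ℝ) + j + ε) / 2) + c₁) (δ * (((i : ℝ) - j) / 2) + c₂)

section

variable {a b k δ : ℝ} (hab : b < a) (hk₀ : 0 < k ^ 2) (hk : k ^ 2 < 1) (hδ : δ ≠ 0)
  (c₁ c₂ : ℝ) (ε : ℤ)
include hab hk₀ hk

omit hab hk₀ in
theorem jacobiCn_pos_of_mem_Ico {s : ℝ} (hs : s ∈ Set.Ico 0 (quarterPeriod k)) :
    0 < jacobiCn s k :=
  jacobiCn_pos_of_abs_lt hk (by rw [abs_of_nonneg hs.1]; exact hs.2)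

theorem contNet_left_line (i : ℤ) : ∃ ℓ, IsLine ℓ ∧
    ∀ j, (i, j) ∈ diagDomain k δ c₂ → contNet a b k δ c₁ c₂ ε i j ∈ ℓ := by
  refine ⟨_, isLine_tangentLine (semiaxis_ne_zero hab hk₀) (semiaxis_ne_zero' hab hk₀ hk)
    (jacobi_sq_add_sq k (δ * (i + ε / 2) + c₁ + c₂)), fun j hj => ?_⟩
  have hc := jacobiCn_pos_of_mem_Ico hk hj
  exact contPoint_mem_of_add_eq hab hk hc.ne' (by ring)

theorem contNet_right_line (j : ℤ) : ∃ ℓ, IsLine ℓ ∧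
    ∀ i, (i, j) ∈ diagDomain k δ c₂ → contNet a b k δ c₁ c₂ ε i j ∈ ℓ := by
  refine ⟨_, isLine_tangentLine (semiaxis_ne_zero hab hk₀) (semiaxis_ne_zero' hab hk₀ hk)
    (jacobi_sq_add_sq k (δ * (j + ε / 2) + c₁ - c₂)), fun i hi => ?_⟩
  have hc := jacobiCn_pos_of_mem_Ico hk hi
  exact contPoint_mem_of_sub_eq hab hk hc.ne' (by ring)

theorem sbtw_contPoint_of_mem_Ico {x y h : ℝ} (h₀ : h ≠ 0)
    (h₁ : y - h ∈ Set.Ico 0 (quarterPeriod k)) (h₂ : y ∈ Set.Ico 0 (quarterPeriod k))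
    (h₃ : y + h ∈ Set.Ico 0 (quarterPeriod k)) :
    Sbtw ℝ (contPoint a b k (x + (y - h)) (y - h)) (contPoint a b k (x + y) y)
      (contPoint a b k (x + (y + h)) (y + h)) ∧
    Sbtw ℝ (contPoint a b k (x - (y + h)) (y + h)) (contPoint a b k (x - y) y)
      (contPoint a b k (x - (y - h)) (y - h)) := by
  have hK : |h| < quarterPeriod k := by
    obtain ⟨_, _⟩ := h₁
    obtain ⟨_, _⟩ := h₂
    obtain ⟨_, _⟩ := h₃
    rw [abs_lt]; constructor <;> linarith
  have hh := jacobiCn_pos_of_abs_lt hk hK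
  have hsh := jacobiSn_ne_zero hk h₀ hK
  have p₁ := jacobiCn_pos_of_mem_Ico hk h₁
  have p₂ := jacobiCn_pos_of_mem_Ico hk h₂
  have p₃ := jacobiCn_pos_of_mem_Ico hk h₃
  have s₁ := jacobiSn_nonneg hk h₁.1 h₁.2
  have s₂ := jacobiSn_nonneg hk h₂.1 h₂.2
  have s₃ := jacobiSn_nonneg hk h₃.1 h₃.2
  refine ⟨sbtw_contPoint hab hk₀ hk hsh hh p₁ p₂ p₃ (mul_nonneg s₁ s₂) (mul_nonneg s₂ s₃), ?_⟩
  have e₁ : -y - h = -(y + h) := by ring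
  have e₂ : -y + h = -(y - h) := by ring
  have := sbtw_contPoint (x := x) (y := -y) hab hk₀ hk hsh hh
    (by rwa [e₁, jacobiCn_neg hk]) (by rwa [jacobiCn_neg hk]) (by rwa [e₂, jacobiCn_neg hk])
    (by rw [e₁, jacobiSn_neg hk, jacobiSn_neg hk, neg_mul_neg]; positivity)
    (by rw [e₂, jacobiSn_neg hk, jacobiSn_neg hk, neg_mul_neg]; positivity)
  rwa [e₁, e₂, contPoint_neg_right hk, contPoint_neg_right hk, contPoint_neg_right hk,
    ← sub_eq_add_neg, ← sub_eq_add_neg, ← sub_eq_add_neg] at this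

include hδ

theorem contNet_left_sbtw {i j : ℤ} (h₁ : (i, j - 1) ∈ diagDomain k δ c₂)
    (h₂ : (i, j) ∈ diagDomain k δ c₂) (h₃ : (i, j + 1) ∈ diagDomain k δ c₂) :
    Sbtw ℝ (contNet a b k δ c₁ c₂ ε i (j - 1)) (contNet a b k δ c₁ c₂ ε i j)
      (contNet a b k δ c₁ c₂ ε i (j + 1)) := by
  have e₁ : δ * (((i : ℝ) - j) / 2) + c₂ + δ / 2 = δ * ((i - (j - 1 : ℤ)) / 2) + c₂ := by
    push_cast; ring
  have e₃ : δ * (((i : ℝ) - j) / 2) + c₂ - δ / 2 = δ * ((i - (j + 1 : ℤ)) / 2) + c₂ := by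
    push_cast; ring
  have := (sbtw_contPoint_of_mem_Ico (x := δ * (i + ε / 2) + c₁ + c₂) (h := δ / 2)
    (y := δ * (((i : ℝ) - j) / 2) + c₂) hab hk₀ hk (by simpa using hδ)
    (e₃ ▸ h₃) h₂ (e₁ ▸ h₁)).2
  rw [e₁, e₃] at this
  simp only [contNet]
  convert this using 2 <;> push_cast <;> ring

theorem contNet_right_sbtw {i j : ℤ} (h₁ : (i - 1, j) ∈ diagDomain k δ c₂)
    (h₂ : (i, j) ∈ diagDomain k δ c₂) (h₃ : (i + 1, j) ∈ diagDomain k δ c₂) :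
    Sbtw ℝ (contNet a b k δ c₁ c₂ ε (i - 1) j) (contNet a b k δ c₁ c₂ ε i j)
      (contNet a b k δ c₁ c₂ ε (i + 1) j) := by
  have e₁ : δ * (((i : ℝ) - j) / 2) + c₂ - δ / 2 = δ * (((i - 1 : ℤ) - j) / 2) + c₂ := by
    push_cast; ring
  have e₃ : δ * (((i : ℝ) - j) / 2) + c₂ + δ / 2 = δ * (((i + 1 : ℤ) - j) / 2) + c₂ := by
    push_cast; ring
  have := (sbtw_contPoint_of_mem_Ico (x := δ * (j + ε / 2) + c₁ - c₂) (h := δ / 2)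
    (y := δ * (((i : ℝ) - j) / 2) + c₂) hab hk₀ hk (by simpa using hδ)
    (e₁ ▸ h₁) h₂ (e₃ ▸ h₃)).1
  rw [e₁, e₃] at this
  simp only [contNet]
  convert this using 2 <;> push_cast <;> ring

theorem isIncircle_contNet {i j : ℤ} (h : SquareIn (diagDomain k δ c₂) i j) :
    IsIncircle
      ⟨incircleCenter a b k (δ * (((i : ℝ) + j + 1 + ε) / 2) + c₁)
          (δ * (((i : ℝ) - j) / 2) + c₂) (δ / 2),
        incircleRadius a b k (δ * (((i : ℝ) + j + 1 + ε) / 2) + c₁)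
          (δ * (((i : ℝ) - j) / 2) + c₂) (δ / 2)⟩
      (contNet a b k δ c₁ c₂ ε i j) (contNet a b k δ c₁ c₂ ε (i + 1) j)
      (contNet a b k δ c₁ c₂ ε (i + 1) (j + 1)) (contNet a b k δ c₁ c₂ ε i (j + 1)) := by
  obtain ⟨-, h₁, -, h₂⟩ := h
  have e₁ : δ * (((i : ℝ) - j) / 2) + c₂ + δ / 2 = δ * (((i + 1 : ℤ) - j) / 2) + c₂ := by
    push_cast; ring
  have e₂ : δ * (((i : ℝ) - j) / 2) + c₂ - δ / 2 = δ * ((i - (j + 1 : ℤ)) / 2) + c₂ := by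
    push_cast; ring
  have := isIncircle_contPoint (u := δ * (((i : ℝ) + j + 1 + ε) / 2) + c₁) (h := δ / 2)
    (w := δ * (((i : ℝ) - j) / 2) + c₂) hab hk₀ hk (by simpa using hδ)
    (e₂ ▸ h₂.1) (e₁ ▸ h₁.1) (e₂ ▸ h₂.2) (e₁ ▸ h₁.2)
  rw [e₁, e₂] at this
  simp only [contNet]
  convert this using 2 <;> push_cast <;> ring

theorem isICNet_contNet : IsICNet (diagDomain k δ c₂) (contNet a b k δ c₁ c₂ ε) where
  line_left := contNet_left_line hab hk₀ hk c₁ c₂ ε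
  line_right := contNet_right_line hab hk₀ hk c₁ c₂ ε
  order_left _ _ := contNet_left_sbtw hab hk₀ hk hδ c₁ c₂ ε
  order_right _ _ := contNet_right_sbtw hab hk₀ hk hδ c₁ c₂ ε
  circumscribed _ _ h := ⟨_, isIncircle_contNet hab hk₀ hk hδ c₁ c₂ ε h⟩

end

theorem mainTheorem9 (a b k : ℝ) (hab : b < a) (hk0 : 0 < k ^ 2) (hk1 : k ^ 2 < 1) :
    -- the continuous coordinate system
    ((∀ s, contF₁ a b k s ^ 2 + contG₁ a b k s ^ 2 = a - b) ∧
      (∀ s, jacobiCn s k ≠ 0 → contF₂ a b k s ^ 2 - contG₂ a b k s ^ 2 = a - b) ∧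
      IsConfocalEllipse a b ((a - b) / k ^ 2) ((a - b) * compModulus k ^ 2 / k ^ 2) ∧
      (∀ ξ : ℝ, ∃ ℓ : AffineSubspace ℝ Plane,
        IsTangentLine ℓ ((a - b) / k ^ 2) ((a - b) * compModulus k ^ 2 / k ^ 2) ∧
        ∀ s₁ s₂ : ℝ, jacobiCn s₂ k ≠ 0 → s₁ + s₂ = ξ → contPoint a b k s₁ s₂ ∈ ℓ) ∧
      (∀ η : ℝ, ∃ ℓ : AffineSubspace ℝ Plane,
        IsTangentLine ℓ ((a - b) / k ^ 2) ((a - b) * compModulus k ^ 2 / k ^ 2) ∧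
        ∀ s₁ s₂ : ℝ, jacobiCn s₂ k ≠ 0 → s₂ - s₁ = η → contPoint a b k s₁ s₂ ∈ ℓ)) ∧
    -- the discrete coordinate system
    (∀ δ c₁ c₂ : ℝ, 0 < jacobiCn (δ / 2) k →
      (∀ n ∈ halfIntegers, discF₁ a b k δ c₁ n * discF₁ a b k δ c₁ (n + 1 / 2) +
        discG₁ a b k δ c₁ n * discG₁ a b k δ c₁ (n + 1 / 2) = a - b) ∧
      (∀ n ∈ halfIntegers, jacobiCn (δ * n + c₂) k ≠ 0 → jacobiCn (δ * (n + 1 / 2) + c₂) k ≠ 0 →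
        discF₂ a b k δ c₂ n * discF₂ a b k δ c₂ (n + 1 / 2) -
          discG₂ a b k δ c₂ n * discG₂ a b k δ c₂ (n + 1 / 2) = a - b) ∧
      IsConfocalEllipse a b
        ((a - b) * (1 / k ^ 2) * (jacobiDn (δ / 2) k ^ 2 / jacobiCn (δ / 2) k ^ 2))
        ((a - b) * (compModulus k ^ 2 / k ^ 2) * (1 / jacobiCn (δ / 2) k ^ 2)) ∧
      (∀ ξ : ℝ, ∃ ℓ : AffineSubspace ℝ Plane,
        IsTangentLine ℓ
          ((a - b) * (1 / k ^ 2) * (jacobiDn (δ / 2) k ^ 2 / jacobiCn (δ / 2) k ^ 2))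
          ((a - b) * (compModulus k ^ 2 / k ^ 2) * (1 / jacobiCn (δ / 2) k ^ 2)) ∧
        ∀ n₁ ∈ halfIntegers, ∀ n₂ ∈ halfIntegers, jacobiCn (δ * n₂ + c₂) k ≠ 0 →
          n₁ + n₂ = ξ → discPoint a b k δ c₁ c₂ n₁ n₂ ∈ ℓ) ∧
      (∀ η : ℝ, ∃ ℓ : AffineSubspace ℝ Plane,
        IsTangentLine ℓ
          ((a - b) * (1 / k ^ 2) * (jacobiDn (δ / 2) k ^ 2 / jacobiCn (δ / 2) k ^ 2))
          ((a - b) * (compModulus k ^ 2 / k ^ 2) * (1 / jacobiCn (δ / 2) k ^ 2)) ∧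
        ∀ n₁ ∈ halfIntegers, ∀ n₂ ∈ halfIntegers, jacobiCn (δ * n₂ + c₂) k ≠ 0 →
          n₁ - n₂ = η → discPoint a b k δ c₁ c₂ n₁ n₂ ∈ ℓ) ∧
      -- the affine transformation to incircular nets
      ∃ T : Plane ≃ᵃ[ℝ] Plane,
        (∀ p : Plane, T p =
          !₂[jacobiCn (δ / 2) k / jacobiDn (δ / 2) k * p 0, jacobiCn (δ / 2) k * p 1]) ∧
        (∀ n₁ ∈ halfIntegers, ∀ n₂ ∈ halfIntegers, jacobiCn (δ * n₂ + c₂) k ≠ 0 →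
          T (discPoint a b k δ c₁ c₂ n₁ n₂) = contPoint a b k (δ * n₁ + c₁) (δ * n₂ + c₂)) ∧
        (δ ≠ 0 → ∀ ε ∈ ({0, 1} : Set ℤ),
          IsICNet (diagDomain k δ c₂) (fun i j => T (diagNet a b k δ c₁ c₂ ε i j)) ∧
          ∀ i j : ℤ, SquareIn (diagDomain k δ c₂) i j →
            ∃ S : EuclideanGeometry.Sphere Plane,
              IsIncircle S (T (diagNet a b k δ c₁ c₂ ε i j)) (T (diagNet a b k δ c₁ c₂ ε (i + 1) j))
                (T (diagNet a b k δ c₁ c₂ ε (i + 1) (j + 1)))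
                (T (diagNet a b k δ c₁ c₂ ε i (j + 1))) ∧
              S.center = discPoint a b k δ c₁ c₂ (((i : ℝ) + j + 1 + ε) / 2) (((i : ℝ) - j) / 2))) := by
  have hk : k ≠ 0 := fun h => by simp [h] at hk0
  refine ⟨⟨contF₁_sq_add_contG₁_sq hab, fun s => contF₂_sq_sub_contG₂_sq hab hk0 hk1,
    isConfocalEllipse_of_sub_eq ?_ ?_,
    fun ξ => ⟨_, isTangentLine_contLine hab hk0 hk1 ξ,
      fun s₁ s₂ hs h => contPoint_mem_of_add_eq hab hk1 hs h⟩,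
    fun η => ⟨_, isTangentLine_contLine hab hk0 hk1 (-η),
      fun s₁ s₂ hs h => contPoint_mem_of_sub_eq hab hk1 hs (by linarith)⟩⟩,
    fun δ c₁ c₂ hδ => ?_⟩
  · have := sub_pos.2 hab
    have := compModulus_pos hk1
    positivity
  · rw [compModulus_sq hk1]
    field_simp
    ring
  have hd := jacobiDn_pos hk1 (δ / 2)
  have hu : jacobiCn (δ / 2) k / jacobiDn (δ / 2) k ≠ 0 := (div_pos hδ hd).ne'
  have hT := planeScaling_discPoint hab hk1 hδ hu hδ.ne' rfl rfl c₁ c₂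
  refine ⟨fun n _ => discF₁_mul_add_discG₁_mul hab hk1 hδ c₁ n,
    fun n _ => discF₂_mul_sub_discG₂_mul hab hk0 hk1 hδ,
    isConfocalEllipse_of_sub_eq ?_ ?_,
    fun ξ => ⟨_, isTangentLine_discLine hab hk0 hk1 hδ (δ * ξ + c₁ + c₂),
      fun n₁ _ n₂ _ hs h => discPoint_mem_of_add_eq hab hk1 hδ hs (by rw [← h]; ring)⟩,
    fun η => ⟨_, isTangentLine_discLine hab hk0 hk1 hδ (δ * η + c₁ - c₂),
      fun n₁ _ n₂ _ hs h => discPoint_mem_of_sub_eq hab hk1 hδ hs (by rw [← h]; ring)⟩,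
    planeScaling _ _ hu hδ.ne', planeScaling_apply hu hδ.ne', fun n₁ _ n₂ _ _ => hT n₁ n₂,
    fun h₀ ε _ => ?_⟩
  · have := sub_pos.2 hab
    have := compModulus_pos hk1
    positivity
  · have h := jacobiDn_sq hk1 (δ / 2)
    rw [compModulus_sq hk1]
    field_simp
    linear_combination (a - b) * (h - k ^ 2 * jacobiCn_sq k (δ / 2))
  · have e (i j : ℤ) : planeScaling _ _ hu hδ.ne' (diagNet a b k δ c₁ c₂ ε i j) =
        contNet a b k δ c₁ c₂ ε i j := hT _ _
    simp only [e]
    exact ⟨isICNet_contNet hab hk0 hk1 h₀ c₁ c₂ ε, fun i j hij =>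
      ⟨_, isIncircle_contNet hab hk0 hk1 h₀ c₁ c₂ ε hij,
        (discPoint_eq_incircleCenter hab hk1 hδ c₁ c₂ _ _).symm⟩⟩
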